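/- Let $\mathcal H$ be the Hilbert space of a single bosonic mode with number states $|n\rangle$ ($n\ge 0$), annihilation operator $a$ and displacement operators $D(\alpha)=\exp(\alpha a^\dagger-\alpha^* a)$, $\alpha\in\mathbb C$. For a density operator $\rho$ on $\mathcal H$ let $\Phi(\alpha)=\operatorname{Tr}[\rho D(\alpha)]$ be its characteristic function. A filter function $\Omega:\mathbb C\to\mathbb C$ is given through its Fourier transform $\tilde\Omega:\mathbb C\to\mathbb R$, assumed Lebesgue integrable, so that $\Omega(\xi)=\int d^2\alpha\,\tilde\Omega(\alpha)e^{\xi\alpha^*-\alpha\xi^*}$. Its filtering map on trace-class operators is $$\mathcal E_\Omega(T)=\int d^2\alpha\,\tilde\Omega(\alpha)\,D(\alpha)\,T\,D(\alpha)^\dagger ,$$ and $\rho_\Omega=\mathcal E_\Omega(\rho)$. A purification of $\rho$ is a vector $\mu$ in $\mathcal H\otimes\mathcal K$, for some Hilbert space $\mathcal K$, with $\operatorname{Tr}_{\mathcal K}|\mu\rangle\langle\mu|=\rho$. The fidelity $F(\rho_1,\rho_2)$ is the maximum (supremum) of $|\langle\mu_1|\mu_2\rangle|^2$ over all purifications $\mu_1$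 of $\rho_1$ and $\mu_2$ of $\rho_2$ in a common space $\mathcal H\otimes\mathcal K$. The entanglement fidelity is $F_e(\rho,\mathcal E)=\langle\mu|(\mathcal E\otimes\mathcal I)(|\mu\rangle\langle\mu|)|\mu\rangle$ for a purification $\mu$ of $\rho$. (1) Suppose that $\mathcal E_\Omega$ is completely positive and trace preserving (CPTP), and let $\rho$ be a density operator on $\mathcal H$. Then the integrals $\int d^2\alpha\,\tilde\Omega(\alpha)D(\alpha)\rho D(\alpha)^\dagger$ (as a Bochner integral in operator norm) and $\int d^2\alpha\,\tilde\Omega(\alpha)|\Phi(\alpha)|^2$ converge absolutely, the value of $F_e(\rho,\mathcal E_\Omega)$ is the same for every purification (and a purification exists), and $$F_e(\rho,\mathcal E_\Omega)=\int d^2\alpha\,\tilde\Omega(\alpha)\,|\Phi(\alpha)|^2\;\le\;F(\rho,\rho_\Omega).$$ If moreover $\rho=|\psi\rangle\langle\psi|$ is pure with $\|\psi\|=1$, then $$F(\rho,\rho_\Omega)=\langle\psi|\mathcal E_\Omega(|\psi\rangle\langle\psi|)|\psi\rangle=\int d^2\alpha\,\tilde\Omega(\alpha)\,|\Phi(\alpha)|^2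 .$$ (2) Let $(\Omega_L)_{L>0}$ be filter functions such that every $\mathcal E_{\Omega_L}$ is CPTP and $\tilde\Omega_L\to\delta^2$ as $L\to\infty$ in the sense of distributions, i.e. $\int d^2\alpha\,\tilde\Omega_L(\alpha)\varphi(\alpha)\to\varphi(0)$ for every smooth compactly supported $\varphi:\mathbb C\to\mathbb R$. Let $\rho$ be a density operator on $\mathcal H$. Then $F_e(\rho,\mathcal E_{\Omega_L})=\int d^2\alpha\,\tilde\Omega_L(\alpha)|\Phi(\alpha)|^2\to 1$ as $L\to\infty$. Hence for every $\varepsilon>0$ there is $L_0>0$ such that for all $L\ge L_0$ $$1-\varepsilon\;\le\;\int d^2\alpha\,\tilde\Omega_L(\alpha)\,|\Phi(\alpha)|^2\;\le\;F(\rho,\rho_{\Omega_L}).$$ -/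

import Mathlib

open MeasureTheory Filter
open scoped InnerProductSpace Topology ContDiff TensorProduct ComplexConjugate

noncomputable section

/-- The Hilbert space `ℓ²(ℕ, ℂ)` of a single bosonic mode, written in its number basis. -/
abbrev FockSpace : Type := lp (fun _ : ℕ => ℂ) 2

/-- The number state `|n⟩`. -/
def numberState (n : ℕ) : FockSpace := lp.single 2 n (1 : ℂ)

/-- A finitely supported sequence `v`, as the vector `∑ v n |n⟩` of the Fock space. -/
def finiteVec : (ℕ →₀ ℂ) →ₗ[ℂ] FockSpace := Finsupp.linearCombination ℂ numberState

/-- The annihilation operator `a |n⟩ = √n |n-1⟩` on finite combinations of number states. -/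
def annihilation : (ℕ →₀ ℂ) →ₗ[ℂ] (ℕ →₀ ℂ) :=
  Finsupp.linearCombination ℂ fun n => Finsupp.single (n - 1) (Real.sqrt n : ℂ)

/-- The creation operator `a† |n⟩ = √(n+1) |n+1⟩` on finite combinations of number states. -/
def creation : (ℕ →₀ ℂ) →ₗ[ℂ] (ℕ →₀ ℂ) :=
  Finsupp.linearCombination ℂ fun n => Finsupp.single (n + 1) (Real.sqrt (n + 1) : ℂ)

/-- `ξ a† - ξ* a` on finite combinations of number states. -/
def displacementGenerator (ξ : ℂ) : Module.End ℂ (ℕ →₀ ℂ) :=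
  ξ • creation - conj ξ • annihilation

/-- The `k`-th term `(ξ a† - ξ* a)^k v / k!` of the exponential series at a finite vector `v`. -/
def displacementTerm (ξ : ℂ) (v : ℕ →₀ ℂ) (k : ℕ) : FockSpace :=
  ((k.factorial : ℂ)⁻¹) • finiteVec ((displacementGenerator ξ ^ k) v)

theorem inner_numberState (m n : ℕ) :
    ⟪numberState m, numberState n⟫_ℂ = if m = n then 1 else 0 := by
  unfold numberState
  rw [lp.inner_single_left]
  simp [lp.single_apply, Pi.single_apply]

theorem inner_creation (v w : ℕ →₀ ℂ) :
    ⟪finiteVec (creation v), finiteVec w⟫_ℂ = ⟪finiteVec v, finiteVec (annihilation w)⟫_ℂ := by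
  induction v using Finsupp.induction_linear with
  | zero => simp
  | add f g hf hg => simp only [map_add, inner_add_left, hf, hg]
  | single m c =>
    induction w using Finsupp.induction_linear with
    | zero => simp
    | add f g hf hg => simp only [map_add, inner_add_right, hf, hg]
    | single n d =>
      simp only [finiteVec, creation, annihilation, Finsupp.linearCombination_single, map_smul,
        inner_smul_left, inner_smul_right, inner_numberState]
      rcases n with _ | n
      · simp
      · by_cases h : m = n
        · subst h; simp [mul_comm]
        · simp [h]

theorem inner_annihilation (v w : ℕ →₀ ℂ) :
    ⟪finiteVec (annihilation v), finiteVec w⟫_ℂ = ⟪finiteVec v, finiteVec (creation w)⟫_ℂ := by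
  rw [← inner_conj_symm, ← inner_creation, inner_conj_symm]

theorem inner_displacementGenerator (ξ : ℂ) (v w : ℕ →₀ ℂ) :
    ⟪finiteVec (displacementGenerator ξ v), finiteVec w⟫_ℂ
      = -⟪finiteVec v, finiteVec (displacementGenerator ξ w)⟫_ℂ := by
  simp only [displacementGenerator, LinearMap.sub_apply, LinearMap.smul_apply, map_sub, map_smul,
    inner_sub_left, inner_sub_right, inner_smul_left, inner_smul_right, inner_creation,
    inner_annihilation, Complex.conj_conj]
  ring

theorem inner_displacementGenerator_pow (ξ : ℂ) (j k : ℕ) (v w : ℕ →₀ ℂ) :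
    ⟪finiteVec ((displacementGenerator ξ ^ j) v),
        finiteVec ((displacementGenerator ξ ^ k) w)⟫_ℂ
      = (-1) ^ j * ⟪finiteVec v, finiteVec ((displacementGenerator ξ ^ (j + k)) w)⟫_ℂ := by
  induction j generalizing k with
  | zero => simp
  | succ j ih =>
    rw [pow_succ', Module.End.mul_apply, inner_displacementGenerator, ← Module.End.mul_apply,
      ← pow_succ', ih, show j + (k + 1) = j + 1 + k by ring]
    ring

theorem displacementGenerator_bound (ξ : ℂ) (N : ℕ) (v : ℕ →₀ ℂ) (hv : ∀ n, N ≤ n → v n = 0) :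
    (∀ n, N + 1 ≤ n → displacementGenerator ξ v n = 0) ∧
      ((displacementGenerator ξ v).sum fun _ c => ‖c‖)
        ≤ 2 * ‖ξ‖ * Real.sqrt N * v.sum fun _ c => ‖c‖ := by
  have hsum : displacementGenerator ξ v = ∑ n ∈ v.support, v n •
      (Finsupp.single (n + 1) (ξ * Real.sqrt (n + 1) : ℂ)
        - Finsupp.single (n - 1) (conj ξ * Real.sqrt n : ℂ)) := by
    simp only [displacementGenerator, creation, annihilation, LinearMap.sub_apply,
      LinearMap.smul_apply, Finsupp.linearCombination_apply, Finsupp.sum, Finset.smul_sum,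
      ← Finset.sum_sub_distrib]
    refine Finset.sum_congr rfl fun n _ => ?_
    ext i
    simp only [Finsupp.sub_apply, Finsupp.smul_apply, Finsupp.single_apply, smul_eq_mul]
    split_ifs <;> ring
  have hlt : ∀ n ∈ v.support, n < N := fun n hn => by
    by_contra h
    exact (Finsupp.mem_support_iff.1 hn) (hv n (not_lt.1 h))
  have hl1 : ∀ (u : ℕ →₀ ℂ) (s : Finset ℕ), u.support ⊆ s →
      (u.sum fun _ c => ‖c‖) = ∑ n ∈ s, ‖u n‖ := fun u s hs =>
    Finsupp.sum_of_support_subset u hs _ (by simp)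
  have h0 : ∀ n, N + 1 ≤ n → displacementGenerator ξ v n = 0 := by
    intro n hn
    rw [hsum, Finsupp.finsetSum_apply]
    refine Finset.sum_eq_zero fun m hm => ?_
    have := hlt m hm
    simp [show m + 1 ≠ n by omega, show m - 1 ≠ n by omega]
  refine ⟨h0, ?_⟩
  have hsub : (displacementGenerator ξ v).support ⊆ Finset.range (N + 1) := by
    intro n hn
    rw [Finset.mem_range]
    by_contra h
    exact (Finsupp.mem_support_iff.1 hn) (h0 n (by omega))
  rw [hl1 _ _ hsub, hsum]
  simp only [Finsupp.finsetSum_apply]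
  calc ∑ n ∈ Finset.range (N + 1), ‖∑ m ∈ v.support, (v m •
          (Finsupp.single (m + 1) (ξ * Real.sqrt (m + 1) : ℂ)
            - Finsupp.single (m - 1) (conj ξ * Real.sqrt m : ℂ))) n‖
      ≤ ∑ n ∈ Finset.range (N + 1), ∑ m ∈ v.support, ‖(v m •
          (Finsupp.single (m + 1) (ξ * Real.sqrt (m + 1) : ℂ)
            - Finsupp.single (m - 1) (conj ξ * Real.sqrt m : ℂ))) n‖ :=
        Finset.sum_le_sum fun n _ => norm_sum_le _ _
    _ = ∑ m ∈ v.support, ∑ n ∈ Finset.range (N + 1), ‖(v m •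
          (Finsupp.single (m + 1) (ξ * Real.sqrt (m + 1) : ℂ)
            - Finsupp.single (m - 1) (conj ξ * Real.sqrt m : ℂ))) n‖ := Finset.sum_comm
    _ ≤ ∑ m ∈ v.support, 2 * ‖ξ‖ * Real.sqrt N * ‖v m‖ := by
        refine Finset.sum_le_sum fun m hm => ?_
        have hm' := hlt m hm
        have h1 : Real.sqrt (m + 1) ≤ Real.sqrt N := Real.sqrt_le_sqrt (by exact_mod_cast hm')
        have h2 : Real.sqrt m ≤ Real.sqrt N := Real.sqrt_le_sqrt (by exact_mod_cast hm'.le)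
        calc _ ≤ ∑ n ∈ Finset.range (N + 1), ‖v m‖ *
              ((if m + 1 = n then ‖ξ‖ * Real.sqrt (m + 1) else 0)
                + (if m - 1 = n then ‖ξ‖ * Real.sqrt m else 0)) := by
              refine Finset.sum_le_sum fun n _ => ?_
              rw [Finsupp.smul_apply, norm_smul, Finsupp.sub_apply]
              refine mul_le_mul_of_nonneg_left ((norm_sub_le _ _).trans ?_) (norm_nonneg _)
              refine add_le_add ?_ ?_
              · rw [Finsupp.single_apply]
                split_ifs
                · simp [abs_of_nonneg (Real.sqrt_nonneg _)]
                · simp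
              · rw [Finsupp.single_apply]
                split_ifs
                · simp [abs_of_nonneg (Real.sqrt_nonneg _)]
                · simp
          _ = ‖v m‖ * (‖ξ‖ * Real.sqrt (m + 1) + ‖ξ‖ * Real.sqrt m) := by
              rw [← Finset.mul_sum, Finset.sum_add_distrib, Finset.sum_ite_eq, Finset.sum_ite_eq,
                if_pos (Finset.mem_range.2 (by omega)), if_pos (Finset.mem_range.2 (by omega))]
          _ ≤ ‖v m‖ * (‖ξ‖ * Real.sqrt N + ‖ξ‖ * Real.sqrt N) := by gcongr
          _ = _ := by ring
    _ = 2 * ‖ξ‖ * Real.sqrt N * v.sum fun _ c => ‖c‖ := by rw [Finsupp.sum, Finset.mul_sum]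

theorem norm_finiteVec_le (v : ℕ →₀ ℂ) : ‖finiteVec v‖ ≤ v.sum fun _ c => ‖c‖ := by
  rw [finiteVec, Finsupp.linearCombination_apply]
  refine (norm_sum_le _ _).trans (Finset.sum_le_sum fun n _ => ?_)
  rw [norm_smul, numberState, lp.norm_single (by norm_num)]
  simp

/-- Finite combinations of number states are entire vectors of `ξ a† - ξ* a`. -/
theorem summable_norm_displacementTerm (ξ : ℂ) (v : ℕ →₀ ℂ) :
    Summable fun k => ‖displacementTerm ξ v k‖ := by
  obtain ⟨N, hN⟩ : ∃ N : ℕ, 0 < N ∧ ∀ n, N ≤ n → v n = 0 := by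
    refine ⟨v.support.sup id + 1, by omega, fun n hn => ?_⟩
    by_contra h
    have := Finset.le_sup (f := id) (Finsupp.mem_support_iff.2 h)
    simp only [id] at this
    omega
  let c : ℕ → ℝ := fun k => (v.sum fun _ c => ‖c‖) *
    ∏ i ∈ Finset.range k, ((2 * ‖ξ‖ + 1) * Real.sqrt ((N + i : ℕ) : ℝ) / (i + 1))
  have hpow : ∀ k, (∀ n, N + k ≤ n → (displacementGenerator ξ ^ k) v n = 0) ∧
      (((displacementGenerator ξ ^ k) v).sum fun _ c => ‖c‖) ≤ c k * k.factorial := by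
    intro k
    induction k with
    | zero => exact ⟨by simpa using hN.2, by simp [c]⟩
    | succ k ih =>
      have hb := displacementGenerator_bound ξ (N + k) _ ih.1
      rw [pow_succ', Module.End.mul_apply]
      refine ⟨hb.1, hb.2.trans ?_⟩
      have hnn : 0 ≤ (((displacementGenerator ξ ^ k) v).sum fun _ c => ‖c‖) :=
        Finset.sum_nonneg fun _ _ => norm_nonneg _
      calc 2 * ‖ξ‖ * Real.sqrt ((N + k : ℕ) : ℝ)
              * (((displacementGenerator ξ ^ k) v).sum fun _ c => ‖c‖)
          ≤ (2 * ‖ξ‖ + 1) * Real.sqrt ((N + k : ℕ) : ℝ) * (c k * k.factorial) := by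
            refine mul_le_mul ?_ ih.2 hnn (by positivity)
            gcongr; linarith
        _ = c (k + 1) * (k + 1).factorial := by
            simp only [c, Finset.prod_range_succ, Nat.factorial_succ]
            push_cast
            field_simp
  have hc0 : ∀ k, 0 ≤ c k := fun k =>
    mul_nonneg (Finset.sum_nonneg fun _ _ => norm_nonneg _)
      (Finset.prod_nonneg fun i _ => by positivity)
  refine Summable.of_nonneg_of_le (fun _ => norm_nonneg _) (f := c) (fun k => ?_) ?_
  · rw [displacementTerm, norm_smul, norm_inv, Complex.norm_natCast]
    have := (norm_finiteVec_le _).trans (hpow k).2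
    rw [inv_mul_le_iff₀ (by positivity)]
    linarith
  · by_cases hv : (v.sum fun _ c => ‖c‖) = 0
    · simp [c, hv]
    refine summable_of_ratio_test_tendsto_lt_one (l := 0) one_pos ?_ ?_
    · refine Eventually.of_forall fun k => mul_ne_zero hv (Finset.prod_ne_zero_iff.2 fun i _ => ?_)
      have : 0 < N + i := by omega
      positivity
    · have hr : ∀ k, ‖c (k + 1)‖ / ‖c k‖
          = (2 * ‖ξ‖ + 1) * Real.sqrt ((N + k : ℕ) : ℝ) / (k + 1) := by
        intro k
        have hk : c k ≠ 0 := mul_ne_zero hv (Finset.prod_ne_zero_iff.2 fun i _ => by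
          have : 0 < N + i := by omega
          positivity)
        have : c (k + 1) = c k * ((2 * ‖ξ‖ + 1) * Real.sqrt ((N + k : ℕ) : ℝ) / (k + 1)) := by
          simp only [c, Finset.prod_range_succ, mul_assoc]
        rw [Real.norm_of_nonneg (hc0 _), Real.norm_of_nonneg (hc0 _), this]
        field_simp
      simp only [hr]
      have hbound : ∀ k : ℕ, (2 * ‖ξ‖ + 1) * Real.sqrt ((N + k : ℕ) : ℝ) / (k + 1)
          ≤ (2 * ‖ξ‖ + 1) * Real.sqrt N * (Real.sqrt ((k : ℝ) + 1))⁻¹ := by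
        intro k
        have hN1 : (1 : ℝ) ≤ N := by exact_mod_cast hN.1
        have h1 : Real.sqrt ((N + k : ℕ) : ℝ) ≤ Real.sqrt N * Real.sqrt ((k : ℝ) + 1) := by
          rw [← Real.sqrt_mul (by positivity)]
          refine Real.sqrt_le_sqrt ?_
          push_cast
          nlinarith [(Nat.cast_nonneg k : (0 : ℝ) ≤ k)]
        have h2 : ((k : ℝ) + 1) = Real.sqrt ((k : ℝ) + 1) * Real.sqrt ((k : ℝ) + 1) :=
          (Real.mul_self_sqrt (by positivity)).symm
        have h3 : 0 < Real.sqrt ((k : ℝ) + 1) := by positivity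
        rw [div_le_iff₀ (by positivity)]
        calc (2 * ‖ξ‖ + 1) * Real.sqrt ((N + k : ℕ) : ℝ)
            ≤ (2 * ‖ξ‖ + 1) * (Real.sqrt N * Real.sqrt ((k : ℝ) + 1)) := by gcongr
          _ = (2 * ‖ξ‖ + 1) * Real.sqrt N * (Real.sqrt ((k : ℝ) + 1))⁻¹
                * (Real.sqrt ((k : ℝ) + 1) * Real.sqrt ((k : ℝ) + 1)) := by field_simp
          _ = _ := by rw [← h2]
      have hlim : Tendsto (fun k : ℕ => (2 * ‖ξ‖ + 1) * Real.sqrt N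
          * (Real.sqrt ((k : ℝ) + 1))⁻¹) atTop (𝓝 0) := by
        rw [← mul_zero ((2 * ‖ξ‖ + 1) * Real.sqrt N)]
        exact (tendsto_inv_atTop_zero.comp (Real.tendsto_sqrt_atTop.comp
          (tendsto_atTop_add_const_right _ _ tendsto_natCast_atTop_atTop))).const_mul _
      exact squeeze_zero (fun k => by positivity) hbound hlim

theorem inner_tsum_displacementTerm (ξ : ℂ) (v w : ℕ →₀ ℂ) :
    ⟪∑' k, displacementTerm ξ v k, ∑' k, displacementTerm ξ w k⟫_ℂ
      = ⟪finiteVec v, finiteVec w⟫_ℂ := by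
  have hf := summable_norm_displacementTerm ξ v
  have hg := summable_norm_displacementTerm ξ w
  have hprod : Summable fun p : ℕ × ℕ => ⟪displacementTerm ξ v p.1, displacementTerm ξ w p.2⟫_ℂ :=
    Summable.of_norm_bounded (hf.mul_of_nonneg hg (fun _ => norm_nonneg _)
      fun _ => norm_nonneg _) fun p => norm_inner_le_norm _ _
  have h1 : ⟪∑' k, displacementTerm ξ v k, ∑' k, displacementTerm ξ w k⟫_ℂ
      = ∑' p : ℕ × ℕ, ⟪displacementTerm ξ v p.1, displacementTerm ξ w p.2⟫_ℂ := by
    rw [hprod.tsum_prod]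
    have hL : ∀ y : FockSpace, HasSum (fun j => ⟪displacementTerm ξ v j, y⟫_ℂ)
        ⟪∑' k, displacementTerm ξ v k, y⟫_ℂ := fun y => by
      have := hf.of_norm.hasSum.mapL (innerSL ℂ y)
      have := this.star
      simpa [innerSL_apply_apply, inner_conj_symm] using this
    have hR : ∀ x : FockSpace, HasSum (fun j => ⟪x, displacementTerm ξ w j⟫_ℂ)
        ⟪x, ∑' k, displacementTerm ξ w k⟫_ℂ := fun x =>
      hg.of_norm.hasSum.mapL (innerSL ℂ x)
    rw [← (hL _).tsum_eq]
    exact tsum_congr fun j => ((hR _).tsum_eq).symm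
  rw [h1, ← Finset.HasAntidiagonal.sigmaAntidiagonalEquivProd.tsum_eq]
  have hs := (Finset.HasAntidiagonal.sigmaAntidiagonalEquivProd (A := ℕ)).summable_iff.2 hprod
  refine (hs.tsum_sigma' (fun n => (hasSum_fintype _).summable)).trans ?_
  have hterm : ∀ n : ℕ, (∑' p : Finset.HasAntidiagonal.antidiagonal n,
      ⟪displacementTerm ξ v p.1.1, displacementTerm ξ w p.1.2⟫_ℂ)
        = if n = 0 then ⟪finiteVec v, finiteVec w⟫_ℂ else 0 := by
    intro n
    rw [tsum_fintype, Finset.sum_coe_sort (Finset.HasAntidiagonal.antidiagonal n)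
      (fun p : ℕ × ℕ => ⟪displacementTerm ξ v p.1, displacementTerm ξ w p.2⟫_ℂ)]
    have : ∀ p ∈ Finset.HasAntidiagonal.antidiagonal n,
        ⟪displacementTerm ξ v p.1, displacementTerm ξ w p.2⟫_ℂ
          = ((n.factorial : ℂ)⁻¹ * ⟪finiteVec v, finiteVec ((displacementGenerator ξ ^ n) w)⟫_ℂ)
            * ((-1) ^ p.1 * 1 ^ p.2 * (n.choose p.1 : ℂ)) := by
      rintro ⟨j, k⟩ hjk
      rw [Finset.HasAntidiagonal.mem_antidiagonal] at hjk
      subst hjk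
      simp only [displacementTerm, inner_smul_left, inner_smul_right,
        inner_displacementGenerator_pow]
      rw [Nat.cast_add_choose]
      have h1 : (j.factorial : ℂ) ≠ 0 := by exact_mod_cast j.factorial_ne_zero
      have h2 : (k.factorial : ℂ) ≠ 0 := by exact_mod_cast k.factorial_ne_zero
      have h3 : ((j + k).factorial : ℂ) ≠ 0 := by exact_mod_cast (j + k).factorial_ne_zero
      simp only [map_inv₀, map_natCast, one_pow]
      field_simp
    rw [Finset.sum_congr rfl this, ← Finset.mul_sum,
      Finset.Nat.sum_antidiagonal_eq_sum_range_succ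
        (fun i j => (-1 : ℂ) ^ i * 1 ^ j * (n.choose i : ℂ)), ← add_pow]
    rcases n with _ | n
    · simp
    · simp
  exact (tsum_congr hterm).trans (tsum_ite_eq _ _)

theorem orthonormal_displacement (ξ : ℂ) :
    Orthonormal ℂ fun n : ℕ => ∑' k, displacementTerm ξ (Finsupp.single n 1) k := by
  rw [orthonormal_iff_ite]
  intro m n
  rw [inner_tsum_displacementTerm, finiteVec, Finsupp.linearCombination_single,
    Finsupp.linearCombination_single, one_smul, one_smul, inner_numberState]

/-- The displacement operator `D(ξ) = exp(ξ a† - ξ* a)`: the isometry whose value at each number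
state is the sum of the exponential series there (see `displacement_numberState`). -/
def displacement (ξ : ℂ) : FockSpace →L[ℂ] FockSpace :=
  (orthonormal_displacement ξ).orthogonalFamily.linearIsometry.toContinuousLinearMap

/-- `D(ξ) |n⟩ = ∑ₖ (ξ a† - ξ* a)^k |n⟩ / k!`. -/
theorem displacement_numberState (ξ : ℂ) (n : ℕ) :
    HasSum (displacementTerm ξ (Finsupp.single n 1)) (displacement ξ (numberState n)) := by
  have h : displacement ξ (numberState n) = ∑' k, displacementTerm ξ (Finsupp.single n 1) k := by
    simp only [displacement, numberState, LinearIsometry.coe_toContinuousLinearMap]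
    rw [OrthogonalFamily.linearIsometry_apply_single]
    simp
  rw [h]
  exact (summable_norm_displacementTerm ξ _).of_norm.hasSum

/-- `T` is a trace-class operator with trace `z`: for every orthonormal basis `b` the series
`∑ ⟨b i| T |b i⟩` converges unconditionally, with sum `z`. -/
def HasTrace {K : Type} [NormedAddCommGroup K] [InnerProductSpace ℂ K] (T : K →L[ℂ] K) (z : ℂ) :
    Prop :=
  ∀ (ι : Type) (b : HilbertBasis ι ℂ K), HasSum (fun i => ⟪b i, T (b i)⟫_ℂ) z

/-- A density operator: positive, of trace one. -/
def IsDensityOperator {K : Type} [NormedAddCommGroup K] [InnerProductSpace ℂ K]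
    (ρ : K →L[ℂ] K) : Prop :=
  ρ.IsPositive ∧ HasTrace ρ 1

/-- The characteristic function `Φ(ξ) = Tr[ρ D(ξ)]`, the trace being taken in the number basis. -/
def characteristicFunction (ρ : FockSpace →L[ℂ] FockSpace) (ξ : ℂ) : ℂ :=
  ∑' n : ℕ, ⟪numberState n, (ρ ∘L displacement ξ) (numberState n)⟫_ℂ

/-- A filter function `Ω`, given together with its Fourier transform `Ω̃`, an integrable real
function on the phase space `ℂ` with `Ω(ξ) = ∫ Ω̃(α) exp(ξ α* - α ξ*) d²α`. -/
structure FilterFunction where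
  toFun : ℂ → ℂ
  fourier : ℂ → ℝ
  integrable_fourier : Integrable fourier
  eq_integral : ∀ ξ, toFun ξ = ∫ α : ℂ, (fourier α : ℂ) * Complex.exp (ξ * conj α - α * conj ξ)

/-- The integrand `Ω̃(α) D(α) T D(α)†` of the filtering map. -/
def filteringIntegrand (Ω : FilterFunction) (T : FockSpace →L[ℂ] FockSpace) (α : ℂ) :
    FockSpace →L[ℂ] FockSpace :=
  (Ω.fourier α : ℂ) • (displacement α ∘L T ∘L ContinuousLinearMap.adjoint (displacement α))

/-- The filtering map `T ↦ ∫ Ω̃(α) D(α) T D(α)† d²α`. The integral is a Bochner integral for the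
operator norm; it converges for trace-class `T`, the operators on which the map is considered. -/
def filteringMap (Ω : FilterFunction) (T : FockSpace →L[ℂ] FockSpace) :
    FockSpace →L[ℂ] FockSpace :=
  ∫ α : ℂ, filteringIntegrand Ω T α

section Bipartite

/-- The Hilbert space tensor product of the mode with an environment `E`. -/
abbrev JointSpace (E : Type) [NormedAddCommGroup E] [InnerProductSpace ℂ E] : Type :=
  UniformSpace.Completion (FockSpace ⊗[ℂ] E)

variable {E : Type} [NormedAddCommGroup E] [InnerProductSpace ℂ E]

/-- The bounded operator `s ↦ s ⊗ e` from the mode to the joint system. -/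
def tensorRight (e : E) : FockSpace →L[ℂ] JointSpace E :=
  UniformSpace.Completion.toComplL ∘L (TensorProduct.mkL ℂ FockSpace E).flip e

theorem tensorRight_apply (e : E) (s : FockSpace) :
    tensorRight e s = ((s ⊗ₜ[ℂ] e : FockSpace ⊗[ℂ] E) : JointSpace E) := rfl

/-- The block `⟨e| T |f⟩` of an operator `T` on the joint system, an operator on the mode. -/
def block (T : JointSpace E →L[ℂ] JointSpace E) (e f : E) : FockSpace →L[ℂ] FockSpace :=
  ContinuousLinearMap.adjoint (tensorRight e) ∘L T ∘L tensorRight f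

/-- `R = (Φ ⊗ I)(T)`: `Φ ⊗ I` acts on every block of `T` by `Φ`. The blocks determine `R`. -/
def IsAmpliation (Φ : (FockSpace →L[ℂ] FockSpace) → (FockSpace →L[ℂ] FockSpace))
    (T R : JointSpace E →L[ℂ] JointSpace E) : Prop :=
  ∀ e f : E, block R e f = Φ (block T e f)

/-- `T` is the partial trace over the environment of the operator `R` on the joint system:
`∑ⱼ ⟨eⱼ| R |eⱼ⟩ = T`, with weak convergence, for every orthonormal basis `e` of the environment. -/
def IsPartialTrace (R : JointSpace E →L[ℂ] JointSpace E) (T : FockSpace →L[ℂ] FockSpace) : Prop :=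
  ∀ (ι : Type) (b : HilbertBasis ι ℂ E) (x y : FockSpace),
    HasSum (fun j => ⟪x, block R (b j) (b j) y⟫_ℂ) ⟪x, T y⟫_ℂ

/-- The vector `μ` of the joint system is a purification of `ρ`: `Tr_E |μ⟩⟨μ| = ρ`. -/
def IsPurification (μ : JointSpace E) (ρ : FockSpace →L[ℂ] FockSpace) : Prop :=
  IsPartialTrace (InnerProductSpace.rankOne ℂ μ μ) ρ

end Bipartite

/-- A completely positive trace-preserving map on the trace-class operators of the mode: linear on
trace-class operators, trace preserving, and such that `(Φ ⊗ I)(ρ)` is positive for every density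
operator `ρ` on the joint system with an arbitrary environment. -/
structure IsCPTP (Φ : (FockSpace →L[ℂ] FockSpace) → (FockSpace →L[ℂ] FockSpace)) : Prop where
  map_add : ∀ S T, (∃ z, HasTrace S z) → (∃ z, HasTrace T z) → Φ (S + T) = Φ S + Φ T
  map_smul : ∀ (c : ℂ) (T), (∃ z, HasTrace T z) → Φ (c • T) = c • Φ T
  trace_preserving : ∀ T z, HasTrace T z → HasTrace (Φ T) z
  completely_positive : ∀ (E : Type) [NormedAddCommGroup E] [InnerProductSpace ℂ E]
    [CompleteSpace E] (ρ : JointSpace E →L[ℂ] JointSpace E), IsDensityOperator ρ →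
    ∃ R, IsAmpliation Φ ρ R ∧ R.IsPositive

/-- `r` is the entanglement fidelity `⟨μ| (Φ ⊗ I)(|μ⟩⟨μ|) |μ⟩` of `ρ` and `Φ`, `μ` being a
purification of `ρ`: a purification exists, and `r` is the value given by each of them. -/
def HasEntanglementFidelity (Φ : (FockSpace →L[ℂ] FockSpace) → (FockSpace →L[ℂ] FockSpace))
    (ρ : FockSpace →L[ℂ] FockSpace) (r : ℝ) : Prop :=
  (∃ (E : Type) (_ : NormedAddCommGroup E) (_ : InnerProductSpace ℂ E) (_ : CompleteSpace E)
    (μ : JointSpace E), IsPurification μ ρ) ∧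
  ∀ (E : Type) [NormedAddCommGroup E] [InnerProductSpace ℂ E] [CompleteSpace E]
    (μ : JointSpace E), IsPurification μ ρ →
    ∃ R, IsAmpliation Φ (InnerProductSpace.rankOne ℂ μ μ) R ∧ ⟪μ, R μ⟫_ℂ = (r : ℂ)

/-- The squared overlaps `|⟨μ₁|μ₂⟩|²` of purifications of `ρ₁` and `ρ₂` in a common joint system. -/
def purificationOverlaps (ρ₁ ρ₂ : FockSpace →L[ℂ] FockSpace) : Set ℝ :=
  {r | ∃ (E : Type) (_ : NormedAddCommGroup E) (_ : InnerProductSpace ℂ E) (_ : CompleteSpace E)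
    (μ₁ μ₂ : JointSpace E), IsPurification μ₁ ρ₁ ∧ IsPurification μ₂ ρ₂ ∧ r = ‖⟪μ₁, μ₂⟫_ℂ‖ ^ 2}

/-- The fidelity `F(ρ₁, ρ₂)`, the maximum of `|⟨μ₁|μ₂⟩|²` over all purifications. For density
operators the overlaps are at most `1`, and the supremum is attained. -/
def fidelity (ρ₁ ρ₂ : FockSpace →L[ℂ] FockSpace) : ℝ :=
  sSup (purificationOverlaps ρ₁ ρ₂)

/-- `∫ Ω̃(α) |Φ(α)|² d²α`, with `Φ` the characteristic function of `ρ`. -/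
def filterOverlap (Ω : FilterFunction) (ρ : FockSpace →L[ℂ] FockSpace) : ℝ :=
  ∫ α : ℂ, Ω.fourier α * ‖characteristicFunction ρ α‖ ^ 2

/-- `f L → δ²` as `L → ∞`, in the sense of distributions on `ℂ = ℝ²`. -/
def TendstoDelta (f : ℝ → ℂ → ℝ) : Prop :=
  ∀ φ : ℂ → ℝ, ContDiff ℝ ∞ φ → HasCompactSupport φ →
    Tendsto (fun L => ∫ α : ℂ, f L α * φ α) atTop (𝓝 (φ 0))

end

/-! Let `μ` purify `ρ`. Then `Φ(α) = ⟨μ|(D(α) ⊗ 1)|μ⟩`, and `(E_Ω ⊗ I)(|μ⟩⟨μ|)` is the integral of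
`Ω̃(α)` times the projector on `(D(α) ⊗ 1)μ`. Sandwiching this operator between copies of `μ` gives
`∫ Ω̃ |Φ|²`, whatever purification was taken. Absolute convergence and the continuity of `Φ` come
from the strong continuity of `D`, which is built up from the Gaussian `⟨0|D(ξ)|0⟩` by ladder
recursions.

The CPTP property is used through two facts: `Ω̃ ≥ 0` almost everywhere (`IsCPTP.fourier_nonneg`)
and `∫ Ω̃ = 1` (`IsCPTP.integral_fourier`). For the first, positivity of the ampliated map on
entangled vectors gives `∫ Ω̃ |f|² ≥ 0` for every finite combination `f` of matrix elements
`⟨m|D|n⟩`. Such `f` are dense in `L²(|Ω̃|)`, so the indicator of `{Ω̃ < 0}` is admissible in the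
limit, and the negative part vanishes. Density holds because multiplication by `α` and `ᾱ` preserves
the span of the matrix elements: a function annihilated by all of them has, once multiplied by the
Gaussian, a vanishing Fourier transform.

For the fidelity bound, `√Ω̃(α) (D(α) ⊗ 1)μ` is a purification of `ρ_Ω` with an `L²` environment.
Its overlap with `μ ⊗ a`, where `a` is proportional to `√Ω̃ Φ` and has norm one, is the square root
of `∫ Ω̃ |Φ|²`. For pure `ρ` each purification is a product vector, and Cauchy–Schwarz gives the
reverse bound. In the limit, `|Φ|²` is continuous with value `1` at `0`, so it dominates a multiple
of a bump function close to `1`, while `Ω̃ ≥ 0` and `∫ Ω̃ = 1` keep the overlap at most `1`. -/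

noncomputable section

/-! ### Matrix elements of the displacement operators in the number basis. -/

section MatrixElements

/-- A scalar commutator `[b, X] = z` makes `[b, ·]` act on powers of `X` as `z d/dX`. -/
theorem apply_pow_of_commutator {V : Type*} [AddCommGroup V] [Module ℂ V] {b X : Module.End ℂ V}
    {z : ℂ} (h : ∀ v, b (X v) = X (b v) + z • v) (k : ℕ) (v : V) :
    b ((X ^ (k + 1)) v) = (X ^ (k + 1)) (b v) + ((k + 1 : ℂ) * z) • (X ^ k) v := by
  induction k with
  | zero => simp [h]
  | succ k ih =>
    rw [pow_succ' X (k + 1), Module.End.mul_apply, h, ih, map_add, map_smul, Module.End.mul_apply,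
      ← Module.End.mul_apply X (X ^ k), ← pow_succ', add_assoc, ← add_smul]
    push_cast
    ring_nf

theorem annihilation_creation (v : ℕ →₀ ℂ) :
    annihilation (creation v) = creation (annihilation v) + v := by
  induction v using Finsupp.induction_linear with
  | zero => simp
  | add f g hf hg => simp only [map_add, hf, hg]; abel
  | single n c =>
    have h1 : (Real.sqrt ((n : ℝ) + 1) : ℂ) * (Real.sqrt ((n : ℝ) + 1) : ℂ) = n + 1 := by
      rw [← Complex.ofReal_mul, Real.mul_self_sqrt (by positivity)]; simp
    have h2 : (Real.sqrt (n : ℝ) : ℂ) * (Real.sqrt (n : ℝ) : ℂ) = n := by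
      rw [← Complex.ofReal_mul, Real.mul_self_sqrt (by positivity)]; simp
    rcases n with _ | n
    · simp [annihilation, creation]
    · simp only [annihilation, creation, Finsupp.linearCombination_single,
        Finsupp.smul_single, smul_eq_mul, add_tsub_cancel_right, ← Finsupp.single_add]
      push_cast at h1 h2 ⊢
      congr 1
      linear_combination c * h1 - c * h2

theorem annihilation_generator (ξ : ℂ) (v : ℕ →₀ ℂ) :
    annihilation (displacementGenerator ξ v) = displacementGenerator ξ (annihilation v) + ξ • v := by
  simp only [displacementGenerator, LinearMap.sub_apply, LinearMap.smul_apply, map_sub, map_smul,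
    annihilation_creation, smul_add]
  abel

theorem creation_generator (ξ : ℂ) (v : ℕ →₀ ℂ) :
    creation (displacementGenerator ξ v)
      = displacementGenerator ξ (creation v) + conj ξ • v := by
  simp only [displacementGenerator, LinearMap.sub_apply, LinearMap.smul_apply, map_sub, map_smul,
    annihilation_creation, smul_add]
  abel

theorem finiteVec_single (n : ℕ) : finiteVec (Finsupp.single n 1) = numberState n := by
  simp [finiteVec]

theorem norm_numberState (n : ℕ) : ‖numberState n‖ = 1 := by
  rw [numberState, lp.norm_single (by norm_num), norm_one]

theorem norm_displacement (ξ : ℂ) (x : FockSpace) : ‖displacement ξ x‖ = ‖x‖ :=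
  LinearIsometry.norm_map _ x

/-- The matrix element `⟨m| D(ξ) |n⟩`. -/
def displacementElement (m n : ℕ) (ξ : ℂ) : ℂ :=
  ⟪numberState m, displacement ξ (numberState n)⟫_ℂ

theorem norm_displacementElement_le (m n : ℕ) (ξ : ℂ) : ‖displacementElement m n ξ‖ ≤ 1 := by
  refine (norm_inner_le_norm _ _).trans ?_
  rw [norm_displacement, norm_numberState, norm_numberState, one_mul]

/-- The coefficient `⟨m| (ξ a† - ξ* a)^k |n⟩`. -/
def generatorElement (m n k : ℕ) (ξ : ℂ) : ℂ :=
  ⟪numberState m, finiteVec ((displacementGenerator ξ ^ k) (Finsupp.single n 1))⟫_ℂ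

theorem hasSum_displacementElement (m n : ℕ) (ξ : ℂ) :
    HasSum (fun k => (k.factorial : ℂ)⁻¹ * generatorElement m n k ξ)
      (displacementElement m n ξ) := by
  have := (displacement_numberState ξ n).mapL (innerSL ℂ (numberState m))
  simpa [displacementTerm, inner_smul_right, generatorElement, displacementElement] using this

theorem inner_annihilation_right (m : ℕ) (v : ℕ →₀ ℂ) :
    ⟪numberState m, finiteVec (annihilation v)⟫_ℂ
      = Real.sqrt (m + 1) * ⟪numberState (m + 1), finiteVec v⟫_ℂ := by
  rw [← finiteVec_single, ← inner_creation, creation, Finsupp.linearCombination_single, one_smul,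
    ← finiteVec_single, ← Finsupp.smul_single_one, map_smul, inner_smul_left]
  simp

theorem inner_creation_right (m : ℕ) (v : ℕ →₀ ℂ) :
    ⟪numberState m, finiteVec (creation v)⟫_ℂ
      = Real.sqrt m * ⟪numberState (m - 1), finiteVec v⟫_ℂ := by
  rw [← finiteVec_single, ← inner_annihilation, annihilation, Finsupp.linearCombination_single,
    one_smul, ← finiteVec_single, ← Finsupp.smul_single_one, map_smul, inner_smul_left]
  simp

/-- Transfers `[b, X] = z` to `[b, exp X] = z exp X` at the level of matrix elements: the factor `k
+ 1` cancels against `(k + 1)!`, so the difference of the first two series, without its vanishing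
zeroth term, is `z` times the third. -/
theorem hasSum_commutator {f g h : ℕ → ℂ} {F G H z : ℂ}
    (hF : HasSum (fun k => (k.factorial : ℂ)⁻¹ * f k) F)
    (hG : HasSum (fun k => (k.factorial : ℂ)⁻¹ * g k) G)
    (hH : HasSum (fun k => (k.factorial : ℂ)⁻¹ * h k) H) (h0 : f 0 = g 0)
    (hs : ∀ k, f (k + 1) = g (k + 1) + ((k + 1 : ℂ) * z) * h k) : F = G + z * H := by
  have h1 := (hasSum_nat_add_iff' 1).2 (hF.sub hG)
  have h2 := hH.mul_left z
  have : (fun k => (((k + 1).factorial : ℂ)⁻¹ * f (k + 1) - ((k + 1).factorial : ℂ)⁻¹ * g (k + 1)))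
      = fun k => z * ((k.factorial : ℂ)⁻¹ * h k) := by
    funext k
    have hk : (k.factorial : ℂ) ≠ 0 := by exact_mod_cast k.factorial_ne_zero
    have hk' : (k + 1 : ℂ) ≠ 0 := by exact_mod_cast k.succ_ne_zero
    rw [hs, Nat.factorial_succ]
    push_cast
    field_simp
    ring
  rw [this] at h1
  have := h1.unique h2
  simp [h0] at this
  linear_combination this

/-- This is `[a, D(ξ)] = ξ D(ξ)` between number states. At `n = 0` the truncated index `n - 1` is
harmless, since its coefficient is `√0`. -/
theorem mul_displacementElement (m n : ℕ) (ξ : ℂ) :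
    ξ * displacementElement m n ξ = Real.sqrt (m + 1) * displacementElement (m + 1) n ξ
      - Real.sqrt n * displacementElement m (n - 1) ξ := by
  have := hasSum_commutator (z := ξ)
    (f := fun k => Real.sqrt (m + 1) * generatorElement (m + 1) n k ξ)
    (g := fun k => Real.sqrt n * generatorElement m (n - 1) k ξ)
    (by simpa [mul_left_comm] using
      (hasSum_displacementElement (m + 1) n ξ).mul_left (Real.sqrt (m + 1) : ℂ))
    (by simpa [mul_left_comm] using
      (hasSum_displacementElement m (n - 1) ξ).mul_left (Real.sqrt n : ℂ))
    (hasSum_displacementElement m n ξ) ?_ ?_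
  · linear_combination -this
  · simp only [generatorElement, pow_zero, Module.End.one_apply]
    rw [← inner_annihilation_right, annihilation, Finsupp.linearCombination_single, one_smul,
      ← Finsupp.smul_single_one, map_smul, inner_smul_right]
  · intro k
    simp only [generatorElement]
    rw [← inner_annihilation_right, apply_pow_of_commutator (annihilation_generator ξ), map_add,
      inner_add_right, map_smul, inner_smul_right, annihilation, Finsupp.linearCombination_single, one_smul,
      ← Finsupp.smul_single_one, map_smul, map_smul, inner_smul_right]

/-- The companion identity `[a†, D(ξ)] = ξ* D(ξ)`. Together the two recursions show that
multiplication by `ξ` and `ξ*` preserves the span of the matrix elements. -/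
theorem conj_mul_displacementElement (m n : ℕ) (ξ : ℂ) :
    conj ξ * displacementElement m n ξ = Real.sqrt m * displacementElement (m - 1) n ξ
      - Real.sqrt (n + 1) * displacementElement m (n + 1) ξ := by
  have := hasSum_commutator (z := conj ξ)
    (f := fun k => Real.sqrt m * generatorElement (m - 1) n k ξ)
    (g := fun k => Real.sqrt (n + 1) * generatorElement m (n + 1) k ξ)
    (by simpa [mul_left_comm] using
      (hasSum_displacementElement (m - 1) n ξ).mul_left (Real.sqrt m : ℂ))
    (by simpa [mul_left_comm] using
      (hasSum_displacementElement m (n + 1) ξ).mul_left (Real.sqrt (n + 1) : ℂ))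
    (hasSum_displacementElement m n ξ) ?_ ?_
  · linear_combination -this
  · simp only [generatorElement, pow_zero, Module.End.one_apply]
    rw [← inner_creation_right, creation, Finsupp.linearCombination_single, one_smul,
      ← Finsupp.smul_single_one, map_smul, inner_smul_right]
  · intro k
    simp only [generatorElement]
    rw [← inner_creation_right, apply_pow_of_commutator (creation_generator ξ), map_add,
      inner_add_right, map_smul, inner_smul_right, creation, Finsupp.linearCombination_single, one_smul,
      ← Finsupp.smul_single_one, map_smul, map_smul, inner_smul_right]

theorem generatorElement_zero_zero_one (ξ : ℂ) : generatorElement 0 0 1 ξ = 0 := by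
  simp [generatorElement, displacementGenerator, creation, annihilation, finiteVec,
    inner_numberState]

/-- The leftmost factor contributes only `-ξ* a`, because `⟨0|a† = 0`; moving `a` through the
remaining power leaves only the commutator term, because `a|0⟩ = 0`. -/
theorem generatorElement_zero_zero_add_two (k : ℕ) (ξ : ℂ) :
    generatorElement 0 0 (k + 2) ξ = -(‖ξ‖ ^ 2 : ℝ) * (k + 1) * generatorElement 0 0 k ξ := by
  have h0 : annihilation (Finsupp.single 0 1) = 0 := by simp [annihilation]
  have h1 : ⟪numberState 0, finiteVec (annihilation
      ((displacementGenerator ξ ^ (k + 1)) (Finsupp.single 0 1)))⟫_ℂ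
      = (k + 1) * ξ * generatorElement 0 0 k ξ := by
    rw [apply_pow_of_commutator (annihilation_generator ξ), h0]
    simp [generatorElement]
  rw [generatorElement, pow_succ', Module.End.mul_apply]
  nth_rw 1 [displacementGenerator]
  rw [LinearMap.sub_apply, LinearMap.smul_apply, LinearMap.smul_apply, map_sub, map_smul, map_smul,
    inner_sub_right, inner_smul_right, inner_smul_right, h1, inner_creation_right]
  have : conj ξ * ξ = (‖ξ‖ ^ 2 : ℝ) := by
    rw [mul_comm, Complex.mul_conj, Complex.normSq_eq_norm_sq]
  simp only [CharP.cast_eq_zero, Real.sqrt_zero, Complex.ofReal_zero]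
  linear_combination -(k + 1 : ℂ) * generatorElement 0 0 k ξ * this

theorem generatorElement_zero_zero_odd (l : ℕ) (ξ : ℂ) : generatorElement 0 0 (2 * l + 1) ξ = 0 := by
  induction l with
  | zero => exact generatorElement_zero_zero_one ξ
  | succ l ih =>
    rw [show 2 * (l + 1) + 1 = 2 * l + 1 + 2 by ring, generatorElement_zero_zero_add_two, ih,
      mul_zero]

theorem generatorElement_zero_zero_even (l : ℕ) (ξ : ℂ) :
    ((2 * l).factorial : ℂ)⁻¹ * generatorElement 0 0 (2 * l) ξ
      = (l.factorial : ℂ)⁻¹ * (-(‖ξ‖ ^ 2 / 2 : ℝ)) ^ l := by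
  induction l with
  | zero => simp [generatorElement, finiteVec_single, norm_numberState]
  | succ l ih =>
    have e1 : ((2 * l).factorial : ℂ) ≠ 0 := by exact_mod_cast (2 * l).factorial_ne_zero
    have e2 : (l.factorial : ℂ) ≠ 0 := by exact_mod_cast l.factorial_ne_zero
    have e3 : (2 * (l : ℂ) + 1) ≠ 0 := by exact_mod_cast (2 * l).succ_ne_zero
    have e4 : ((l : ℂ) + 1) ≠ 0 := by exact_mod_cast l.succ_ne_zero
    have e5 : (2 * (l : ℂ) + 1 + 1) = 2 * (l + 1) := by ring
    have e6 : (((l + 1).factorial : ℕ) : ℂ)⁻¹ * (-(‖ξ‖ ^ 2 / 2 : ℝ)) ^ (l + 1)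
        = (l + 1 : ℂ)⁻¹ * (-(‖ξ‖ ^ 2 / 2 : ℝ))
          * ((l.factorial : ℂ)⁻¹ * (-(‖ξ‖ ^ 2 / 2 : ℝ)) ^ l) := by
      rw [Nat.factorial_succ, pow_succ]
      push_cast
      field_simp
    rw [e6, ← ih, show 2 * (l + 1) = 2 * l + 2 by ring, generatorElement_zero_zero_add_two,
      Nat.factorial_succ, Nat.factorial_succ]
    push_cast
    rw [e5]
    field_simp

theorem displacementElement_zero_zero (ξ : ℂ) :
    displacementElement 0 0 ξ = (Real.exp (-(‖ξ‖ ^ 2 / 2)) : ℝ) := by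
  let f : ℕ → ℂ := fun k => (k.factorial : ℂ)⁻¹ * generatorElement 0 0 k ξ
  have h1 : HasSum (fun l => f (2 * l)) ((Real.exp (-(‖ξ‖ ^ 2 / 2)) : ℝ) : ℂ) := by
    have h := NormedSpace.exp_series_hasSum_exp' (𝕂 := ℂ) (-((‖ξ‖ ^ 2 / 2 : ℝ) : ℂ))
    rw [← Complex.exp_eq_exp_ℂ, ← Complex.ofReal_neg, ← Complex.ofReal_exp] at h
    refine h.congr_fun fun l => ?_
    simp only [f, generatorElement_zero_zero_even, smul_eq_mul, Complex.ofReal_neg]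
  have h2 : HasSum (fun l => f (2 * l + 1)) 0 := by
    simp only [f, generatorElement_zero_zero_odd, mul_zero]
    exact hasSum_zero
  have h3 : HasSum f (displacementElement 0 0 ξ) := hasSum_displacementElement 0 0 ξ
  have h4 := h1.even_add_odd h2
  rw [add_zero] at h4
  exact h3.unique h4

/-- Starting from the Gaussian at `(0, 0)`, one recursion raises `m` along `n = 0` and the other
then raises `n`. -/
theorem continuous_displacementElement (m n : ℕ) : Continuous (displacementElement m n) := by
  have key : ∀ k : ℕ, (k : ℝ) + 1 > 0 := fun k => by positivity
  have hm : ∀ m, Continuous (displacementElement m 0) := by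
    intro m
    induction m with
    | zero =>
      have : displacementElement 0 0 = fun ξ : ℂ => ((Real.exp (-(‖ξ‖ ^ 2 / 2)) : ℝ) : ℂ) :=
        funext displacementElement_zero_zero
      rw [this]
      fun_prop
    | succ m ih =>
      have : displacementElement (m + 1) 0
          = fun ξ => ((Real.sqrt (m + 1) : ℝ) : ℂ)⁻¹ * (ξ * displacementElement m 0 ξ) := by
        funext ξ
        have hne : ((Real.sqrt (m + 1) : ℝ) : ℂ) ≠ 0 :=
          Complex.ofReal_ne_zero.2 (Real.sqrt_pos.2 (key m)).ne'
        rw [mul_displacementElement]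
        field_simp
        simp
      rw [this]
      fun_prop
  induction n generalizing m with
  | zero => exact hm m
  | succ n ih =>
    have : displacementElement m (n + 1)
        = fun ξ => ((Real.sqrt (n + 1) : ℝ) : ℂ)⁻¹ *
          (Real.sqrt m * displacementElement (m - 1) n ξ - conj ξ * displacementElement m n ξ) := by
      funext ξ
      have hne : ((Real.sqrt (n + 1) : ℝ) : ℂ) ≠ 0 :=
        Complex.ofReal_ne_zero.2 (Real.sqrt_pos.2 (key n)).ne'
      rw [conj_mul_displacementElement]
      field_simp
      ring
    rw [this]
    have h1 := ih m
    have h2 := ih (m - 1)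
    have h3 := Complex.continuous_conj
    fun_prop

end MatrixElements

/-! ### Strong continuity of the displacement operators. -/

section StrongContinuity

/-- Under a uniform bound, approximating `v` by vectors of the span approximates `F · v` uniformly
in the parameter, and uniform limits of continuous maps are continuous. -/
theorem continuous_apply_of_span_dense {X V W : Type*} [TopologicalSpace X] [NormedAddCommGroup V]
    [NormedSpace ℂ V] [NormedAddCommGroup W] [NormedSpace ℂ W] {F : X → V →L[ℂ] W} {C : ℝ}
    (hF : ∀ a v, ‖F a v‖ ≤ C * ‖v‖) {S : Set V} (hS : (Submodule.span ℂ S).topologicalClosure = ⊤)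
    (h : ∀ v ∈ S, Continuous fun a => F a v) (v : V) : Continuous fun a => F a v := by
  have hspan : ∀ w ∈ Submodule.span ℂ S, Continuous fun a => F a w := by
    intro w hw
    induction hw using Submodule.span_induction with
    | mem x hx => exact h x hx
    | zero => simpa using continuous_const
    | add x y _ _ hx hy => simp only [map_add]; exact hx.add hy
    | smul c x _ hx => simp only [map_smul]; exact hx.const_smul c
  refine continuous_of_uniform_approx_of_continuous fun u hu => ?_
  obtain ⟨ε, hε, hεu⟩ := Metric.mem_uniformity_dist.1 hu
  have hv : v ∈ closure (Submodule.span ℂ S : Set V) := by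
    rw [← Submodule.topologicalClosure_coe, hS]; trivial
  obtain ⟨w, hw, hvw⟩ := Metric.mem_closure_iff.1 hv (ε / (|C| + 1)) (by positivity)
  refine ⟨fun a => F a w, hspan w hw, fun a => hεu ?_⟩
  rw [dist_eq_norm] at hvw ⊢
  rw [← map_sub]
  calc ‖F a (v - w)‖ ≤ C * ‖v - w‖ := hF a _
    _ ≤ (|C| + 1) * ‖v - w‖ := by gcongr; linarith [le_abs_self C]
    _ < (|C| + 1) * (ε / (|C| + 1)) := by gcongr
    _ = ε := by field_simp

/-- The number basis of the Fock space. -/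
def numberBasis : HilbertBasis ℕ ℂ FockSpace := ⟨LinearIsometryEquiv.refl ℂ FockSpace⟩

@[simp] theorem numberBasis_apply (n : ℕ) : numberBasis n = numberState n := by
  rw [← HilbertBasis.repr_symm_single]
  rfl

theorem numberState_span : (Submodule.span ℂ (Set.range numberState)).topologicalClosure = ⊤ := by
  rw [← numberBasis.dense_span]
  congr 3
  funext n
  exact (numberBasis_apply n).symm

/-- For isometries weak continuity implies strong continuity, and weak continuity reduces by density
to the matrix elements. -/
theorem continuous_displacement (x : FockSpace) : Continuous fun ξ => displacement ξ x := by
  have hb : ∀ (ξ : ℂ) (v : FockSpace), ‖displacement ξ v‖ ≤ 1 * ‖v‖ := fun ξ v => by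
    rw [norm_displacement, one_mul]
  refine continuous_apply_of_span_dense hb numberState_span ?_ x
  rintro _ ⟨n, rfl⟩
  have hweak : ∀ y, Continuous fun ξ => ⟪y, displacement ξ (numberState n)⟫_ℂ := by
    -- The density argument needs maps linear in the varying vector, so `y` is put in the second
    -- slot of the inner product and the result is conjugated afterwards.
    have hconj : ∀ y, Continuous fun ξ => innerSL ℂ (displacement ξ (numberState n)) y := by
      refine continuous_apply_of_span_dense (C := 1) (fun ξ v => ?_) numberState_span ?_
      · rw [innerSL_apply_apply]
        refine (norm_inner_le_norm _ _).trans ?_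
        rw [norm_displacement, norm_numberState]
      · rintro _ ⟨m, rfl⟩
        simp only [innerSL_apply_apply]
        have := Complex.continuous_conj.comp (continuous_displacementElement m n)
        simpa [Function.comp_def, displacementElement] using this
    intro y
    have := Complex.continuous_conj.comp (hconj y)
    simpa [Function.comp_def] using this
  rw [continuous_iff_continuousAt]
  intro ξ₀
  rw [ContinuousAt, tendsto_iff_norm_sub_tendsto_zero]
  have hsq : ∀ ξ, ‖displacement ξ (numberState n) - displacement ξ₀ (numberState n)‖
      = Real.sqrt (2 - 2 * RCLike.re
        ⟪displacement ξ₀ (numberState n), displacement ξ (numberState n)⟫_ℂ) := by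
    intro ξ
    rw [← Real.sqrt_sq (norm_nonneg (displacement ξ (numberState n) - _)), norm_sub_sq (𝕜 := ℂ),
      norm_displacement, norm_displacement, norm_numberState, inner_re_symm]
    ring_nf
  simp only [hsq]
  have hc : Continuous fun ξ => Real.sqrt (2 - 2 * RCLike.re
        ⟪displacement ξ₀ (numberState n), displacement ξ (numberState n)⟫_ℂ) :=
    Real.continuous_sqrt.comp (continuous_const.sub (continuous_const.mul
      (RCLike.continuous_re.comp (hweak _))))
  have h0 := hc.tendsto ξ₀
  rw [inner_self_eq_norm_sq, norm_displacement, norm_numberState] at h0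
  simpa using h0

theorem displacement_zero : displacement 0 = ContinuousLinearMap.id ℂ FockSpace := by
  have h : ∀ n, displacement 0 (numberState n) = numberState n := by
    intro n
    have h1 := displacement_numberState 0 n
    have h2 : displacementGenerator 0 = 0 :=
      LinearMap.ext fun v => by simp [displacementGenerator, LinearMap.sub_apply]
    have h3 : HasSum (displacementTerm 0 (Finsupp.single n 1)) (numberState n) := by
      have := hasSum_single (f := displacementTerm 0 (Finsupp.single n 1)) 0 (fun k hk => by
        simp [displacementTerm, h2, zero_pow hk])
      simpa [displacementTerm, finiteVec_single] using this
    exact h1.unique h3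
  refine ContinuousLinearMap.ext_on ?_ (s := Set.range numberState) ?_
  · rw [Submodule.dense_iff_topologicalClosure_eq_top]; exact numberState_span
  · rintro _ ⟨n, rfl⟩
    exact h n

end StrongContinuity

/-! ### The joint system: slices of vectors, ampliations and purifications. -/

section JointSystem

variable {E : Type} [NormedAddCommGroup E] [InnerProductSpace ℂ E]

theorem inner_tensorRight (x y : FockSpace) (e f : E) :
    ⟪tensorRight e x, tensorRight f y⟫_ℂ = ⟪x, y⟫_ℂ * ⟪e, f⟫_ℂ := by
  rw [tensorRight_apply, tensorRight_apply, UniformSpace.Completion.inner_coe,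
    TensorProduct.inner_tmul]

/-- The bounded operator `e ↦ x ⊗ e` from the environment to the joint system. -/
def tensorLeft (x : FockSpace) : E →L[ℂ] JointSpace E :=
  UniformSpace.Completion.toComplL ∘L TensorProduct.mkL ℂ FockSpace E x

theorem tensorLeft_apply (x : FockSpace) (e : E) : tensorLeft x e = tensorRight e x := rfl

theorem span_tensorRight :
    (Submodule.span ℂ (Set.range fun p : FockSpace × E => tensorRight p.2 p.1)).topologicalClosure
      = ⊤ := by
  rw [Submodule.topologicalClosure_eq_top_iff, Submodule.eq_bot_iff]
  intro μ hμ
  rw [Submodule.mem_orthogonal] at hμ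
  have hz : ∀ z : FockSpace ⊗[ℂ] E, ⟪(z : JointSpace E), μ⟫_ℂ = 0 := by
    intro z
    induction z using TensorProduct.induction_on with
    | zero => rw [UniformSpace.Completion.coe_zero, inner_zero_left]
    | tmul x e => exact hμ _ (Submodule.subset_span ⟨(x, e), rfl⟩)
    | add x y hx hy => rw [UniformSpace.Completion.coe_add, inner_add_left, hx, hy, add_zero]
  have hall : ∀ ν : JointSpace E, ⟪ν, μ⟫_ℂ = 0 := fun ν =>
    UniformSpace.Completion.induction_on ν
      (isClosed_eq (continuous_id.inner continuous_const) continuous_const) hz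
  exact inner_self_eq_zero.1 (hall μ)

theorem joint_ext_inner {μ ν : JointSpace E}
    (h : ∀ (x : FockSpace) (e : E), ⟪tensorRight e x, μ⟫_ℂ = ⟪tensorRight e x, ν⟫_ℂ) : μ = ν := by
  have hmem : μ - ν ∈ (Submodule.span ℂ
      (Set.range fun p : FockSpace × E => tensorRight p.2 p.1))ᗮ := by
    rw [Submodule.mem_orthogonal]
    intro u hu
    induction hu using Submodule.span_induction with
    | mem u hu =>
      obtain ⟨p, rfl⟩ := hu
      rw [inner_sub_right, h, sub_self]
    | zero => simp
    | add u v _ _ hu hv => rw [inner_add_left, hu, hv, add_zero]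
    | smul c u _ hu => rw [inner_smul_left, hu, mul_zero]
  rw [Submodule.topologicalClosure_eq_top_iff.1 span_tensorRight] at hmem
  exact sub_eq_zero.1 ((Submodule.mem_bot ℂ).1 hmem)

/-- The operator `A ⊗ 1` on the joint system. -/
def ampliate (A : FockSpace →L[ℂ] FockSpace) : JointSpace E →L[ℂ] JointSpace E :=
  (UniformSpace.Completion.toComplL ∘L
    TensorProduct.mapL A (ContinuousLinearMap.id ℂ E)).extend UniformSpace.Completion.toComplL

theorem ampliate_tensorRight (A : FockSpace →L[ℂ] FockSpace) (e : E) (x : FockSpace) :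
    ampliate A (tensorRight e x) = tensorRight e (A x) := by
  rw [ampliate, tensorRight_apply]
  exact ContinuousLinearMap.extend_eq _ UniformSpace.Completion.denseRange_coe
    (UniformSpace.Completion.isUniformInducing_coe _) _

theorem norm_ampliate_le (A : FockSpace →L[ℂ] FockSpace) :
    ‖(ampliate A : JointSpace E →L[ℂ] JointSpace E)‖ ≤ ‖A‖ := by
  refine (ContinuousLinearMap.opNorm_extend_le (N := 1) _
    UniformSpace.Completion.denseRange_coe fun x => ?_).trans ?_
  · simp
  · rw [NNReal.coe_one, one_mul]
    refine (ContinuousLinearMap.opNorm_comp_le _ _).trans ?_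
    have h1 : ‖(UniformSpace.Completion.toComplL :
        (FockSpace ⊗[ℂ] E) →L[ℂ] JointSpace E)‖ ≤ 1 :=
      ContinuousLinearMap.opNorm_le_bound _ zero_le_one fun x => by simp
    have h2 : ‖TensorProduct.mapL A (ContinuousLinearMap.id ℂ E)‖ ≤ ‖A‖ * 1 :=
      (TensorProduct.norm_mapL_le _ _).trans (by
        gcongr; exact ContinuousLinearMap.norm_id_le)
    calc _ ≤ 1 * (‖A‖ * 1) := by gcongr
      _ = ‖A‖ := by ring

/-- The operator `D(ξ) ⊗ 1` on the joint system. -/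
def jointDisplacement (ξ : ℂ) : JointSpace E →L[ℂ] JointSpace E := ampliate (displacement ξ)

theorem jointDisplacement_tensorRight (ξ : ℂ) (e : E) (x : FockSpace) :
    jointDisplacement ξ (tensorRight e x) = tensorRight e (displacement ξ x) :=
  ampliate_tensorRight _ _ _

theorem norm_displacement_le (ξ : ℂ) : ‖displacement ξ‖ ≤ 1 :=
  ContinuousLinearMap.opNorm_le_bound _ zero_le_one fun x => by rw [norm_displacement, one_mul]

theorem norm_jointDisplacement_le (ξ : ℂ) (μ : JointSpace E) :
    ‖jointDisplacement ξ μ‖ ≤ ‖μ‖ := by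
  refine ((jointDisplacement ξ).le_opNorm μ).trans ?_
  have := (norm_ampliate_le (E := E) (displacement ξ)).trans (norm_displacement_le ξ)
  calc _ ≤ 1 * ‖μ‖ := by gcongr; exact this
    _ = _ := one_mul _

theorem continuous_jointDisplacement (μ : JointSpace E) :
    Continuous fun ξ => jointDisplacement ξ μ := by
  refine continuous_apply_of_span_dense (C := 1) (fun ξ v => ?_) span_tensorRight ?_ μ
  · rw [one_mul]; exact norm_jointDisplacement_le ξ v
  · rintro _ ⟨⟨x, e⟩, rfl⟩
    simp only [jointDisplacement_tensorRight]
    exact (tensorRight e).continuous.comp (continuous_displacement x)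

theorem jointDisplacement_zero (μ : JointSpace E) : jointDisplacement 0 μ = μ := by
  have : (jointDisplacement 0 : JointSpace E →L[ℂ] JointSpace E)
      = ContinuousLinearMap.id ℂ (JointSpace E) := by
    refine ContinuousLinearMap.ext_on
      (s := Set.range fun p : FockSpace × E => tensorRight p.2 p.1) ?_ ?_
    · rw [Submodule.dense_iff_topologicalClosure_eq_top]; exact span_tensorRight
    · rintro _ ⟨⟨x, e⟩, rfl⟩
      simp only [jointDisplacement_tensorRight, displacement_zero, ContinuousLinearMap.id_apply]
  rw [this, ContinuousLinearMap.id_apply]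

/-- Operators on different tensor factors commute: `(1 ⊗ ⟨e|)(D ⊗ 1) = D(1 ⊗ ⟨e|)`. -/
theorem adjoint_tensorRight_jointDisplacement (e : E) (ξ : ℂ) (μ : JointSpace E) :
    ContinuousLinearMap.adjoint (tensorRight e) (jointDisplacement ξ μ)
      = displacement ξ (ContinuousLinearMap.adjoint (tensorRight e) μ) := by
  have h : ContinuousLinearMap.adjoint (tensorRight e) ∘L jointDisplacement ξ
      = displacement ξ ∘L ContinuousLinearMap.adjoint (tensorRight e) := by
    refine ContinuousLinearMap.ext_on
      (s := Set.range fun p : FockSpace × E => tensorRight p.2 p.1) ?_ ?_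
    · rw [Submodule.dense_iff_topologicalClosure_eq_top]; exact span_tensorRight
    · rintro _ ⟨⟨x, f⟩, rfl⟩
      have : ∀ y : FockSpace, ContinuousLinearMap.adjoint (tensorRight e) (tensorRight f y)
          = ⟪e, f⟫_ℂ • y := fun y => by
        refine ext_inner_left ℂ fun z => ?_
        rw [ContinuousLinearMap.adjoint_inner_right, inner_tensorRight, inner_smul_right, mul_comm]
      simp only [ContinuousLinearMap.comp_apply, jointDisplacement_tensorRight, this, map_smul]
  exact congrArg (fun T => T μ) h

theorem block_rankOne (μ : JointSpace E) (e f : E) :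
    block (InnerProductSpace.rankOne ℂ μ μ) e f
      = InnerProductSpace.rankOne ℂ (ContinuousLinearMap.adjoint (tensorRight e) μ)
          (ContinuousLinearMap.adjoint (tensorRight f) μ) := by
  rw [block, InnerProductSpace.rankOne_comp, InnerProductSpace.comp_rankOne]

variable [CompleteSpace E]

theorem adjoint_tensorLeft_tensorLeft (x y : FockSpace) (e : E) :
    ContinuousLinearMap.adjoint (tensorLeft x) (tensorLeft y e) = ⟪x, y⟫_ℂ • e := by
  refine ext_inner_left ℂ fun z => ?_
  rw [ContinuousLinearMap.adjoint_inner_right, tensorLeft_apply, tensorLeft_apply,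
    inner_tensorRight, inner_smul_right]

theorem adjoint_jointDisplacement (ξ : ℂ) (x : FockSpace) (μ : JointSpace E) :
    ContinuousLinearMap.adjoint (tensorLeft x) (ContinuousLinearMap.adjoint (jointDisplacement ξ) μ)
      = ContinuousLinearMap.adjoint (tensorLeft (displacement ξ x)) μ := by
  refine ext_inner_left ℂ fun z => ?_
  simp only [ContinuousLinearMap.adjoint_inner_right, tensorLeft_apply,
    jointDisplacement_tensorRight]

theorem inner_adjoint_tensorLeft (x : FockSpace) (e : E) (μ : JointSpace E) :
    ⟪e, ContinuousLinearMap.adjoint (tensorLeft x) μ⟫_ℂ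
      = ⟪x, ContinuousLinearMap.adjoint (tensorRight e) μ⟫_ℂ := by
  rw [ContinuousLinearMap.adjoint_inner_right, ContinuousLinearMap.adjoint_inner_right,
    tensorLeft_apply]

theorem adjoint_tensorLeft_jointDisplacement (ξ : ℂ) (x : FockSpace) (μ : JointSpace E) :
    ContinuousLinearMap.adjoint (tensorLeft x) (jointDisplacement ξ μ)
      = ContinuousLinearMap.adjoint
        (tensorLeft (ContinuousLinearMap.adjoint (displacement ξ) x)) μ := by
  refine ext_inner_left ℂ fun z => ?_
  rw [inner_adjoint_tensorLeft, inner_adjoint_tensorLeft, adjoint_tensorRight_jointDisplacement,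
    ContinuousLinearMap.adjoint_inner_left]

/-- Parseval in the environment sums the partial trace, giving a basis-free criterion: the Gram
matrix of the slices `(⟨x| ⊗ 1)μ` is the transposed matrix of `ρ`. -/
theorem isPurification_iff {μ : JointSpace E} {ρ : FockSpace →L[ℂ] FockSpace} :
    IsPurification μ ρ ↔ ∀ x y : FockSpace, ⟪ContinuousLinearMap.adjoint (tensorLeft y) μ,
      ContinuousLinearMap.adjoint (tensorLeft x) μ⟫_ℂ = ⟪x, ρ y⟫_ℂ := by
  have key : ∀ (ι : Type) (b : HilbertBasis ι ℂ E) (x y : FockSpace),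
      HasSum (fun j => ⟪x, block (InnerProductSpace.rankOne ℂ μ μ) (b j) (b j) y⟫_ℂ)
        ⟪ContinuousLinearMap.adjoint (tensorLeft y) μ,
          ContinuousLinearMap.adjoint (tensorLeft x) μ⟫_ℂ := by
    intro ι b x y
    refine (b.hasSum_inner_mul_inner (ContinuousLinearMap.adjoint (tensorLeft y) μ)
      (ContinuousLinearMap.adjoint (tensorLeft x) μ)).congr_fun fun j => ?_
    rw [block_rankOne, InnerProductSpace.rankOne_apply, inner_smul_right,
      inner_adjoint_tensorLeft, ← inner_conj_symm _ (b j), inner_adjoint_tensorLeft,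
      inner_conj_symm]
  constructor
  · intro h x y
    obtain ⟨w, b, -⟩ := exists_hilbertBasis ℂ E
    exact (key w b x y).unique (h w b x y)
  · intro h ι b x y
    rw [← h]
    exact key ι b x y

/-- The vectors `|n⟩ ⊗ b j` form a Hilbert basis of the joint space; Parseval for it, summed first
over `j`, is the decomposition of an inner product into slices. -/
theorem hasSum_inner_adjoint_tensorLeft (μ ν : JointSpace E) :
    HasSum (fun n => ⟪ContinuousLinearMap.adjoint (tensorLeft (numberState n)) μ,
      ContinuousLinearMap.adjoint (tensorLeft (numberState n)) ν⟫_ℂ) ⟪μ, ν⟫_ℂ := by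
  classical
  obtain ⟨w, b, -⟩ := exists_hilbertBasis ℂ E
  have horth : Orthonormal ℂ fun p : ℕ × w => tensorRight (b p.2) (numberState p.1) := by
    rw [orthonormal_iff_ite]
    rintro ⟨m, i⟩ ⟨n, j⟩
    rw [inner_tensorRight, inner_numberState, orthonormal_iff_ite.1 b.orthonormal]
    by_cases h1 : m = n <;> by_cases h2 : i = j <;> simp [h1, h2]
  let B : HilbertBasis (ℕ × w) ℂ (JointSpace E) := HilbertBasis.mkOfOrthogonalEqBot horth (by
    rw [Submodule.eq_bot_iff]
    intro κ hκ
    rw [Submodule.mem_orthogonal] at hκ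
    have h1 : ∀ n, ContinuousLinearMap.adjoint (tensorLeft (numberState n)) κ = 0 := by
      intro n
      refine b.repr.injective ?_
      ext j
      rw [b.repr_apply_apply, inner_adjoint_tensorLeft, ContinuousLinearMap.adjoint_inner_right,
        hκ _ (Submodule.subset_span ⟨(n, j), rfl⟩)]
      simp
    refine joint_ext_inner fun x e => ?_
    rw [← ContinuousLinearMap.adjoint_inner_right]
    have h2 : ContinuousLinearMap.adjoint (tensorRight e) κ = 0 := by
      refine numberBasis.repr.injective ?_
      ext n
      rw [numberBasis.repr_apply_apply, numberBasis_apply, ← inner_adjoint_tensorLeft, h1]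
      simp
    rw [h2]
    simp)
  have hB : ∀ p, B p = tensorRight (b p.2) (numberState p.1) := fun p =>
    congrFun (HilbertBasis.coe_mkOfOrthogonalEqBot horth _) p
  refine (B.hasSum_inner_mul_inner μ ν).prod_fiberwise fun n => ?_
  refine (b.hasSum_inner_mul_inner (ContinuousLinearMap.adjoint (tensorLeft (numberState n)) μ)
    (ContinuousLinearMap.adjoint (tensorLeft (numberState n)) ν)).congr_fun fun j => ?_
  rw [hB, ContinuousLinearMap.adjoint_inner_right, ContinuousLinearMap.adjoint_inner_left,
    tensorLeft_apply]

/-- Slices may be prescribed: `∑ |n⟩ ⊗ η n` converges because its terms are orthogonal with summable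
squared norms. -/
theorem exists_joint_of_summable {η : ℕ → E} (hη : Summable fun n => ‖η n‖ ^ 2) :
    ∃ μ : JointSpace E, ∀ n, ContinuousLinearMap.adjoint (tensorLeft (numberState n)) μ = η n := by
  let V : ℕ → E →ₗᵢ[ℂ] JointSpace E := fun n =>
    { (tensorLeft (numberState n)).toLinearMap with
      norm_map' := fun e => by
        change ‖((numberState n ⊗ₜ[ℂ] e : FockSpace ⊗[ℂ] E) : JointSpace E)‖ = ‖e‖
        rw [UniformSpace.Completion.norm_coe, TensorProduct.norm_tmul, norm_numberState, one_mul] }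
  have hV : OrthogonalFamily ℂ (fun _ : ℕ => E) V := by
    intro m n hmn e f
    change ⟪tensorRight e (numberState m), tensorRight f (numberState n)⟫_ℂ = 0
    rw [inner_tensorRight, inner_numberState, if_neg hmn, zero_mul]
  have hs := (hV.summable_iff_norm_sq_summable η).2 hη
  refine ⟨∑' n, V n (η n), fun n => ?_⟩
  have h1 := hs.hasSum.mapL (ContinuousLinearMap.adjoint (tensorLeft (numberState n)))
  have h2 : (fun m => ContinuousLinearMap.adjoint (tensorLeft (numberState n)) (V m (η m)))
      = fun m => if m = n then η n else 0 := by
    funext m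
    change ContinuousLinearMap.adjoint (tensorLeft (numberState n))
      (tensorLeft (numberState m) (η m)) = _
    rw [adjoint_tensorLeft_tensorLeft, inner_numberState]
    by_cases h : m = n
    · simp [h]
    · simp [h, Ne.symm h]
  rw [h2] at h1
  exact h1.unique (hasSum_ite_eq n (η n))

/-- The characteristic function of `ρ` in terms of a purification. -/
theorem characteristicFunction_eq_inner {μ : JointSpace E} {ρ : FockSpace →L[ℂ] FockSpace}
    (hμ : IsPurification μ ρ) (ξ : ℂ) :
    characteristicFunction ρ ξ = ⟪μ, jointDisplacement ξ μ⟫_ℂ := by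
  rw [characteristicFunction, ← ContinuousLinearMap.adjoint_inner_left,
    ← (hasSum_inner_adjoint_tensorLeft (ContinuousLinearMap.adjoint (jointDisplacement ξ) μ)
      μ).tsum_eq]
  refine tsum_congr fun n => ?_
  rw [adjoint_jointDisplacement, isPurification_iff.1 hμ]
  rfl

theorem IsPurification.norm_eq_one {μ : JointSpace E} {ρ : FockSpace →L[ℂ] FockSpace}
    (hμ : IsPurification μ ρ) (hρ : HasTrace ρ 1) : ‖μ‖ = 1 := by
  have h1 := hasSum_inner_adjoint_tensorLeft μ μ
  simp only [isPurification_iff.1 hμ] at h1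
  have h2 := hρ ℕ numberBasis
  simp only [numberBasis_apply] at h2
  have h3 := h1.unique h2
  rw [inner_self_eq_norm_sq_to_K] at h3
  have h4 : ‖μ‖ ^ 2 = 1 := Complex.ofReal_injective (by simpa using h3)
  nlinarith [norm_nonneg μ]

end JointSystem

/-! ### Existence of purifications and rank-one expansions. -/

section Purifications

theorem inner_numberState_left (n : ℕ) (x : FockSpace) : ⟪numberState n, x⟫_ℂ = x n := by
  unfold numberState
  rw [lp.inner_single_left]
  simp

theorem fock_ext_inner {x y : FockSpace} (h : ∀ n, ⟪numberState n, x⟫_ℂ = ⟪numberState n, y⟫_ℂ) :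
    x = y := by
  ext n
  rw [← inner_numberState_left, h, inner_numberState_left]

theorem inner_star_star (x y : FockSpace) : ⟪star x, star y⟫_ℂ = ⟪y, x⟫_ℂ := by
  refine (lp.hasSum_inner (𝕜 := ℂ) (star x) (star y)).unique ?_
  refine (lp.hasSum_inner (𝕜 := ℂ) y x).congr_fun fun n => ?_
  simp [RCLike.inner_apply, mul_comm]

/-- The positive square root of a positive operator. -/
theorem exists_sqrt {H : Type*} [NormedAddCommGroup H] [InnerProductSpace ℂ H] [CompleteSpace H]
    {ρ : H →L[ℂ] H} (hρ : ρ.IsPositive) :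
    ∃ S : H →L[ℂ] H, (∀ x y, ⟪S x, y⟫_ℂ = ⟪x, S y⟫_ℂ) ∧
      ∀ x y, ⟪S x, S y⟫_ℂ = ⟪x, ρ y⟫_ℂ := by
  have h0 : 0 ≤ ρ := (ContinuousLinearMap.nonneg_iff_isPositive ρ).2 hρ
  have hS := (ContinuousLinearMap.nonneg_iff_isPositive _).1 (CFC.sqrt_nonneg ρ)
  refine ⟨CFC.sqrt ρ, fun x y => hS.isSymmetric x y, fun x y => ?_⟩
  have h1 : ⟪CFC.sqrt ρ x, CFC.sqrt ρ y⟫_ℂ = ⟪x, CFC.sqrt ρ (CFC.sqrt ρ y)⟫_ℂ :=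
    hS.isSymmetric x _
  rw [h1, ← mul_apply_eq_comp, CFC.sqrt_mul_sqrt_self ρ h0]

variable {E : Type} [NormedAddCommGroup E] [InnerProductSpace ℂ E] [CompleteSpace E]

/-- The criterion extends from number states to all vectors one slot at a time; self-adjointness of
`ρ` serves the second slot. -/
theorem isPurification_of_numberState {μ : JointSpace E} {ρ : FockSpace →L[ℂ] FockSpace}
    (hsa : ∀ x y, ⟪ρ x, y⟫_ℂ = ⟪x, ρ y⟫_ℂ)
    (h : ∀ m n, ⟪ContinuousLinearMap.adjoint (tensorLeft (numberState m)) μ,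
      ContinuousLinearMap.adjoint (tensorLeft (numberState n)) μ⟫_ℂ
        = ⟪numberState n, ρ (numberState m)⟫_ℂ) : IsPurification μ ρ := by
  rw [isPurification_iff]
  have h1 : ∀ x m, ⟪ContinuousLinearMap.adjoint (tensorLeft (numberState m)) μ,
      ContinuousLinearMap.adjoint (tensorLeft x) μ⟫_ℂ = ⟪x, ρ (numberState m)⟫_ℂ := by
    intro x m
    rw [inner_adjoint_tensorLeft]
    congr 1
    refine fock_ext_inner fun n => ?_
    rw [← inner_adjoint_tensorLeft, h]
  intro x y
  rw [inner_adjoint_tensorLeft]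
  congr 1
  refine fock_ext_inner fun n => ?_
  rw [← inner_adjoint_tensorLeft, ← inner_conj_symm, h1, inner_conj_symm, hsa]

/-- Every purification below is built from its slices by this lemma; the trace condition makes them
square-summable. -/
theorem exists_isPurification_of_gram {η : ℕ → E} {ρ : FockSpace →L[ℂ] FockSpace}
    (hsa : ∀ x y, ⟪ρ x, y⟫_ℂ = ⟪x, ρ y⟫_ℂ) (htr : HasTrace ρ 1)
    (h : ∀ m n, ⟪η m, η n⟫_ℂ = ⟪numberState n, ρ (numberState m)⟫_ℂ) :
    ∃ μ : JointSpace E, IsPurification μ ρ ∧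
      ∀ n, ContinuousLinearMap.adjoint (tensorLeft (numberState n)) μ = η n := by
  have hs : Summable fun n => ‖η n‖ ^ 2 := by
    have h2 := (Complex.hasSum_re (htr ℕ numberBasis)).summable
    refine h2.congr fun n => ?_
    rw [numberBasis_apply, ← h, inner_self_eq_norm_sq_to_K]
    norm_cast
  obtain ⟨μ, hμ⟩ := exists_joint_of_summable hs
  exact ⟨μ, isPurification_of_numberState hsa fun m n => by rw [hμ, hμ, h], hμ⟩

/-- The slices are the complex conjugates of `√ρ|n⟩`: conjugation supplies the transposition in the
Gram condition. -/
theorem exists_isPurification {ρ : FockSpace →L[ℂ] FockSpace} (hρ : IsDensityOperator ρ) :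
    ∃ μ : JointSpace FockSpace, IsPurification μ ρ := by
  obtain ⟨S, -, hSS⟩ := exists_sqrt hρ.1
  obtain ⟨μ, hμ, -⟩ := exists_isPurification_of_gram (η := fun n => star (S (numberState n)))
    (fun x y => hρ.1.isSymmetric x y) hρ.2 fun m n => by rw [inner_star_star, hSS]
  exact ⟨μ, hμ⟩

/-- With `s n = √ρ|n⟩` the norms of the terms sum to the trace, so the expansion converges in
operator norm, as needed for the Bochner integral. -/
theorem exists_hasSum_rankOne {ρ : FockSpace →L[ℂ] FockSpace} (hρ : IsDensityOperator ρ) :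
    ∃ s : ℕ → FockSpace, HasSum (fun n => InnerProductSpace.rankOne ℂ (s n) (s n)) ρ := by
  obtain ⟨S, hS, hSS⟩ := exists_sqrt hρ.1
  refine ⟨fun n => S (numberState n), ?_⟩
  have hs : Summable fun n =>
      InnerProductSpace.rankOne ℂ (S (numberState n)) (S (numberState n)) := by
    refine Summable.of_norm ?_
    have h2 := (Complex.hasSum_re (hρ.2 ℕ numberBasis)).summable
    refine h2.congr fun n => ?_
    rw [numberBasis_apply, ← hSS, InnerProductSpace.norm_rankOne, inner_self_eq_norm_sq_to_K, ← sq]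
    norm_cast
  convert hs.hasSum using 1
  ext1 y
  refine ext_inner_left ℂ fun x => ?_
  have h1 := hs.hasSum.mapL ((innerSL ℂ x) ∘L (ContinuousLinearMap.apply ℂ FockSpace y))
  refine HasSum.unique ?_ h1
  rw [← hSS]
  refine (numberBasis.hasSum_inner_mul_inner (S x) (S y)).congr_fun fun n => ?_
  simp only [ContinuousLinearMap.comp_apply, ContinuousLinearMap.apply_apply, innerSL_apply_apply,
    InnerProductSpace.rankOne_apply, inner_smul_right, numberBasis_apply, hS]
  rw [← hS x, mul_comm]

end Purifications

/-! ### The filtering map, its ampliation and the entanglement fidelity. -/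

section Filtering

theorem FilterFunction.integrable_smul (Ω : FilterFunction) {V : Type*} [NormedAddCommGroup V]
    [NormedSpace ℂ V] {f : ℂ → V} {C : ℝ} (hf : AEStronglyMeasurable f) (hC : ∀ α, ‖f α‖ ≤ C) :
    Integrable fun α => (Ω.fourier α : ℂ) • f α := by
  refine Integrable.mono' (Ω.integrable_fourier.norm.mul_const C)
    (Ω.integrable_fourier.ofReal.aestronglyMeasurable.smul hf) (ae_of_all _ fun α => ?_)
  rw [norm_smul, Complex.norm_real]
  gcongr
  exact hC α

theorem FilterFunction.integrable_mul (Ω : FilterFunction) {f : ℂ → ℝ} {C : ℝ}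
    (hf : AEStronglyMeasurable f) (hC : ∀ α, ‖f α‖ ≤ C) :
    Integrable fun α => Ω.fourier α * f α :=
  Ω.integrable_fourier.mul_bdd hf (ae_of_all _ hC)

theorem continuous_rankOne {V : Type*} [NormedAddCommGroup V] [InnerProductSpace ℂ V]
    {f g : ℂ → V} (hf : Continuous f) (hg : Continuous g) :
    Continuous fun α => InnerProductSpace.rankOne ℂ (f α) (g α) :=
  ((ContinuousLinearMap.smulRightL ℂ V V).continuous.comp
    ((innerSL ℂ).continuous.comp hg)).clm_apply hf

theorem displacement_conj_rankOne (α : ℂ) (u v : FockSpace) :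
    displacement α ∘L InnerProductSpace.rankOne ℂ u v
        ∘L ContinuousLinearMap.adjoint (displacement α)
      = InnerProductSpace.rankOne ℂ (displacement α u) (displacement α v) := by
  rw [InnerProductSpace.rankOne_comp, InnerProductSpace.comp_rankOne,
    ContinuousLinearMap.adjoint_adjoint]

theorem filteringIntegrand_rankOne (Ω : FilterFunction) (u v : FockSpace) (α : ℂ) :
    filteringIntegrand Ω (InnerProductSpace.rankOne ℂ u v) α = (Ω.fourier α : ℂ) •
      InnerProductSpace.rankOne ℂ (displacement α u) (displacement α v) := by
  rw [filteringIntegrand, displacement_conj_rankOne]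

theorem integrable_filteringIntegrand_rankOne (Ω : FilterFunction) (u v : FockSpace) :
    Integrable (filteringIntegrand Ω (InnerProductSpace.rankOne ℂ u v)) := by
  have : filteringIntegrand Ω (InnerProductSpace.rankOne ℂ u v) = _ :=
    funext (filteringIntegrand_rankOne Ω u v)
  rw [this]
  refine Ω.integrable_smul (C := ‖u‖ * ‖v‖)
    (continuous_rankOne (continuous_displacement u) (continuous_displacement v)).aestronglyMeasurable
    fun α => ?_
  rw [InnerProductSpace.norm_rankOne, norm_displacement, norm_displacement]

theorem norm_displacement_conj_le (T : FockSpace →L[ℂ] FockSpace) (α : ℂ) :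
    ‖displacement α ∘L T ∘L ContinuousLinearMap.adjoint (displacement α)‖ ≤ ‖T‖ := by
  have h1 := norm_displacement_le α
  have h2 : ‖ContinuousLinearMap.adjoint (displacement α)‖ ≤ 1 := by
    rwa [LinearIsometryEquiv.norm_map]
  calc _ ≤ ‖displacement α‖ * ‖T ∘L ContinuousLinearMap.adjoint (displacement α)‖ :=
        ContinuousLinearMap.opNorm_comp_le _ _
    _ ≤ ‖displacement α‖ * (‖T‖ * ‖ContinuousLinearMap.adjoint (displacement α)‖) := by
        gcongr; exact ContinuousLinearMap.opNorm_comp_le _ _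
    _ ≤ 1 * (‖T‖ * 1) := by gcongr
    _ = ‖T‖ := by ring

/-- The point is norm continuity of `α ↦ D(α) ρ D(α)†`. It is clear for finite sums of rank-one
operators, and conjugation by `D(α)` does not increase norms, so the truncation error for `ρ` is
uniform in `α`. -/
theorem integrable_filteringIntegrand (Ω : FilterFunction) {ρ : FockSpace →L[ℂ] FockSpace}
    (hρ : IsDensityOperator ρ) : Integrable (filteringIntegrand Ω ρ) := by
  obtain ⟨s, hs⟩ := exists_hasSum_rankOne hρ
  refine Ω.integrable_smul (C := ‖ρ‖) (Continuous.aestronglyMeasurable ?_)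
    (norm_displacement_conj_le ρ)
  refine continuous_of_uniform_approx_of_continuous fun u hu => ?_
  obtain ⟨ε, hε, hεu⟩ := Metric.mem_uniformity_dist.1 hu
  obtain ⟨N, hN⟩ := (Metric.tendsto_atTop.1 hs.tendsto_sum_nat) ε hε
  refine ⟨fun α => ∑ n ∈ Finset.range N,
    InnerProductSpace.rankOne ℂ (displacement α (s n)) (displacement α (s n)),
    continuous_finsetSum _ fun n _ =>
      continuous_rankOne (continuous_displacement _) (continuous_displacement _),
    fun α => hεu ?_⟩
  have h1 := hN N le_rfl
  rw [dist_comm] at h1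
  rw [dist_eq_norm] at h1 ⊢
  refine lt_of_le_of_lt ?_ h1
  have h2 : ∑ n ∈ Finset.range N,
      InnerProductSpace.rankOne ℂ (displacement α (s n)) (displacement α (s n))
      = displacement α ∘L (∑ n ∈ Finset.range N, InnerProductSpace.rankOne ℂ (s n) (s n))
        ∘L ContinuousLinearMap.adjoint (displacement α) := by
    rw [ContinuousLinearMap.finsetSum_comp, ContinuousLinearMap.comp_finsetSum]
    exact Finset.sum_congr rfl fun n _ => (displacement_conj_rankOne α _ _).symm
  beta_reduce
  rw [h2, ← ContinuousLinearMap.comp_sub, ← ContinuousLinearMap.sub_comp]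
  exact norm_displacement_conj_le _ α

theorem inner_filteringMap (Ω : FilterFunction) {T : FockSpace →L[ℂ] FockSpace}
    (hT : Integrable (filteringIntegrand Ω T)) (x y : FockSpace) :
    ⟪x, filteringMap Ω T y⟫_ℂ = ∫ α, (Ω.fourier α : ℂ) *
      ⟪ContinuousLinearMap.adjoint (displacement α) x,
        T (ContinuousLinearMap.adjoint (displacement α) y)⟫_ℂ := by
  have h := ((innerSL ℂ x) ∘L (ContinuousLinearMap.apply ℂ FockSpace y)).integral_comp_comm hT
  rw [filteringMap]
  refine h.symm.trans (integral_congr_ae (ae_of_all _ fun α => ?_))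
  simp only [ContinuousLinearMap.comp_apply, ContinuousLinearMap.apply_apply, innerSL_apply_apply,
    filteringIntegrand, _root_.smul_apply, inner_smul_right,
    ContinuousLinearMap.adjoint_inner_left]

theorem inner_filteringMap_rankOne (Ω : FilterFunction) (u v x y : FockSpace) :
    ⟪x, filteringMap Ω (InnerProductSpace.rankOne ℂ u v) y⟫_ℂ = ∫ α, (Ω.fourier α : ℂ) *
      (⟪x, displacement α u⟫_ℂ * ⟪displacement α v, y⟫_ℂ) := by
  rw [inner_filteringMap Ω (integrable_filteringIntegrand_rankOne Ω u v)]
  refine integral_congr_ae (ae_of_all _ fun α => ?_)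
  simp only [InnerProductSpace.rankOne_apply, inner_smul_right,
    ContinuousLinearMap.adjoint_inner_left, ContinuousLinearMap.adjoint_inner_right, mul_comm]

theorem inner_filteringMap_symm (Ω : FilterFunction) {ρ : FockSpace →L[ℂ] FockSpace}
    (hρ : IsDensityOperator ρ) (x y : FockSpace) :
    ⟪filteringMap Ω ρ x, y⟫_ℂ = ⟪x, filteringMap Ω ρ y⟫_ℂ := by
  rw [← inner_conj_symm, inner_filteringMap Ω (integrable_filteringIntegrand Ω hρ),
    inner_filteringMap Ω (integrable_filteringIntegrand Ω hρ), ← integral_conj]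
  refine integral_congr_ae (ae_of_all _ fun α => ?_)
  have h : ∀ x y, ⟪ρ x, y⟫_ℂ = ⟪x, ρ y⟫_ℂ := fun x y => hρ.1.isSymmetric x y
  simp only [map_mul, Complex.conj_ofReal, inner_conj_symm, h]

variable {E : Type} [NormedAddCommGroup E] [InnerProductSpace ℂ E]

/-- `(E_Ω ⊗ I)(|μ⟩⟨μ|)`. -/
def jointFiltering (Ω : FilterFunction) (μ : JointSpace E) : JointSpace E →L[ℂ] JointSpace E :=
  ∫ α : ℂ, (Ω.fourier α : ℂ) •
    InnerProductSpace.rankOne ℂ (jointDisplacement α μ) (jointDisplacement α μ)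

theorem integrable_jointFiltering (Ω : FilterFunction) (μ : JointSpace E) :
    Integrable fun α : ℂ => (Ω.fourier α : ℂ) •
      InnerProductSpace.rankOne ℂ (jointDisplacement α μ) (jointDisplacement α μ) := by
  refine Ω.integrable_smul (C := ‖μ‖ * ‖μ‖) (continuous_rankOne (continuous_jointDisplacement μ)
    (continuous_jointDisplacement μ)).aestronglyMeasurable fun α => ?_
  rw [InnerProductSpace.norm_rankOne]
  have := norm_jointDisplacement_le α μ
  gcongr

theorem inner_jointFiltering (Ω : FilterFunction) (μ κ ν : JointSpace E) :
    ⟪κ, jointFiltering Ω μ ν⟫_ℂ = ∫ α, (Ω.fourier α : ℂ) *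
      (⟪κ, jointDisplacement α μ⟫_ℂ * ⟪jointDisplacement α μ, ν⟫_ℂ) := by
  have h := ((innerSL ℂ κ) ∘L (ContinuousLinearMap.apply ℂ (JointSpace E) ν)).integral_comp_comm
    (integrable_jointFiltering Ω μ)
  rw [jointFiltering]
  refine h.symm.trans (integral_congr_ae (ae_of_all _ fun α => ?_))
  simp only [ContinuousLinearMap.comp_apply, ContinuousLinearMap.apply_apply, innerSL_apply_apply,
    _root_.smul_apply, inner_smul_right, InnerProductSpace.rankOne_apply]
  ring

/-- Each block of a rank-one operator is rank one, built from slices of `μ`, and slicing the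
environment commutes with `D(α) ⊗ 1`. -/
theorem isAmpliation_jointFiltering (Ω : FilterFunction) (μ : JointSpace E) :
    IsAmpliation (filteringMap Ω) (InnerProductSpace.rankOne ℂ μ μ) (jointFiltering Ω μ) := by
  intro e f
  ext1 y
  refine ext_inner_left ℂ fun x => ?_
  rw [block_rankOne, inner_filteringMap_rankOne, block, ContinuousLinearMap.comp_apply,
    ContinuousLinearMap.comp_apply, ContinuousLinearMap.adjoint_inner_right, inner_jointFiltering]
  simp only [← adjoint_tensorRight_jointDisplacement, ContinuousLinearMap.adjoint_inner_left,
    ContinuousLinearMap.adjoint_inner_right]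

variable [CompleteSpace E]

theorem inner_jointFiltering_self (Ω : FilterFunction) {μ : JointSpace E}
    {ρ : FockSpace →L[ℂ] FockSpace} (hμ : IsPurification μ ρ) :
    ⟪μ, jointFiltering Ω μ μ⟫_ℂ = (filterOverlap Ω ρ : ℂ) := by
  rw [inner_jointFiltering, filterOverlap, ← integral_complex_ofReal]
  refine integral_congr_ae (ae_of_all _ fun α => ?_)
  simp only [characteristicFunction_eq_inner hμ]
  rw [← inner_conj_symm (jointDisplacement α μ) μ, Complex.mul_conj, Complex.normSq_eq_norm_sq]
  push_cast
  rfl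

theorem continuous_characteristicFunction {ρ : FockSpace →L[ℂ] FockSpace}
    (hρ : IsDensityOperator ρ) : Continuous (characteristicFunction ρ) := by
  obtain ⟨μ, hμ⟩ := exists_isPurification hρ
  have : characteristicFunction ρ = _ := funext (characteristicFunction_eq_inner hμ)
  rw [this]
  exact continuous_const.inner (continuous_jointDisplacement μ)

theorem norm_characteristicFunction_le {ρ : FockSpace →L[ℂ] FockSpace}
    (hρ : IsDensityOperator ρ) (α : ℂ) : ‖characteristicFunction ρ α‖ ≤ 1 := by
  obtain ⟨μ, hμ⟩ := exists_isPurification hρ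
  rw [characteristicFunction_eq_inner hμ]
  have h1 := hμ.norm_eq_one hρ.2
  have h2 := norm_jointDisplacement_le α μ
  refine (norm_inner_le_norm _ _).trans ?_
  rw [h1] at h2 ⊢
  linarith

theorem characteristicFunction_zero {ρ : FockSpace →L[ℂ] FockSpace}
    (hρ : IsDensityOperator ρ) : characteristicFunction ρ 0 = 1 := by
  obtain ⟨μ, hμ⟩ := exists_isPurification hρ
  rw [characteristicFunction_eq_inner hμ, jointDisplacement_zero, inner_self_eq_norm_sq_to_K,
    hμ.norm_eq_one hρ.2]
  simp

theorem integrable_filterOverlap (Ω : FilterFunction) {ρ : FockSpace →L[ℂ] FockSpace}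
    (hρ : IsDensityOperator ρ) :
    Integrable (fun α : ℂ => Ω.fourier α * ‖characteristicFunction ρ α‖ ^ 2) := by
  refine Ω.integrable_mul (C := 1)
    ((continuous_characteristicFunction hρ).norm.pow 2).aestronglyMeasurable fun α => ?_
  rw [Real.norm_of_nonneg (by positivity)]
  exact pow_le_one₀ (norm_nonneg _) (norm_characteristicFunction_le hρ α)

theorem hasEntanglementFidelity_filteringMap (Ω : FilterFunction) {ρ : FockSpace →L[ℂ] FockSpace}
    (hρ : IsDensityOperator ρ) :
    HasEntanglementFidelity (filteringMap Ω) ρ (filterOverlap Ω ρ) := by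
  obtain ⟨μ, hμ⟩ := exists_isPurification hρ
  refine ⟨⟨FockSpace, inferInstance, inferInstance, inferInstance, μ, hμ⟩, ?_⟩
  intro E _ _ _ ν hν
  exact ⟨jointFiltering Ω ν, isAmpliation_jointFiltering Ω ν, inner_jointFiltering_self Ω hν⟩

end Filtering

/-! ### Matrix elements of displacements separate integrable functions. -/

section FourierUniqueness

/-- The positive and negative parts of `u` are densities of two finite measures with the same
characteristic function, hence of the same measure. -/
theorem ae_eq_zero_of_integral_exp_eq_zero_real {u : ℂ → ℝ} (hu : Integrable u)
    (h : ∀ t : ℂ, ∫ α, (u α : ℂ) * Complex.exp ((inner ℝ α t : ℝ) * Complex.I) = 0) :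
    u =ᵐ[volume] 0 := by
  have hm : AEMeasurable (fun α => ENNReal.ofReal (u α)) volume := hu.1.aemeasurable.ennreal_ofReal
  have hm' : AEMeasurable (fun α => ENNReal.ofReal (-u α)) volume :=
    hu.neg.1.aemeasurable.ennreal_ofReal
  have hf : ∫⁻ α, ENNReal.ofReal (u α) ≠ ⊤ := hu.lintegral_lt_top.ne
  have hf' : ∫⁻ α, ENNReal.ofReal (-u α) ≠ ⊤ := hu.neg.lintegral_lt_top.ne
  have : IsFiniteMeasure (volume.withDensity fun α => ENNReal.ofReal (u α)) :=
    isFiniteMeasure_withDensity hf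
  have : IsFiniteMeasure (volume.withDensity fun α => ENNReal.ofReal (-u α)) :=
    isFiniteMeasure_withDensity hf'
  have hmeas : (volume.withDensity fun α => ENNReal.ofReal (u α))
      = volume.withDensity fun α => ENNReal.ofReal (-u α) := by
    refine Measure.ext_of_charFun (funext fun t => ?_)
    rw [charFun_apply, charFun_apply,
      integral_withDensity_eq_integral_toReal_smul₀ hm (ae_of_all _ fun _ => ENNReal.ofReal_lt_top),
      integral_withDensity_eq_integral_toReal_smul₀ hm' (ae_of_all _ fun _ => ENNReal.ofReal_lt_top),
      ← sub_eq_zero, ← integral_sub, ← h t]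
    · refine integral_congr_ae (ae_of_all _ fun α => ?_)
      simp only [ENNReal.toReal_ofReal', Complex.real_smul]
      rcases le_total (u α) 0 with h0 | h0
      · rw [max_eq_right h0, max_eq_left (by linarith)]; push_cast; ring
      · rw [max_eq_left h0, max_eq_right (by linarith)]; push_cast; ring
    all_goals
      have hexp : Continuous fun α : ℂ => Complex.exp ((inner ℝ α t : ℝ) * Complex.I) := by
        fun_prop
    · refine Integrable.mono' hu.norm (hm.ennreal_toReal.aestronglyMeasurable.smul
        hexp.aestronglyMeasurable) (ae_of_all _ fun α => ?_)
      rw [norm_smul, Complex.norm_exp_ofReal_mul_I, mul_one, ENNReal.toReal_ofReal',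
        Real.norm_of_nonneg (le_max_right _ _)]
      exact max_le (le_abs_self _) (norm_nonneg _)
    · refine Integrable.mono' hu.norm (hm'.ennreal_toReal.aestronglyMeasurable.smul
        hexp.aestronglyMeasurable) (ae_of_all _ fun α => ?_)
      rw [norm_smul, Complex.norm_exp_ofReal_mul_I, mul_one, ENNReal.toReal_ofReal',
        Real.norm_of_nonneg (le_max_right _ _)]
      exact max_le (neg_le_abs _) (norm_nonneg _)
  have h2 := (withDensity_eq_iff hm hm' hf).1 hmeas
  filter_upwards [h2] with α hα
  change u α = 0
  rcases le_total (u α) 0 with h0 | h0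
  · rw [ENNReal.ofReal_of_nonpos h0, eq_comm, ENNReal.ofReal_eq_zero] at hα
    exact le_antisymm h0 (by linarith)
  · rw [ENNReal.ofReal_of_nonpos (p := -u α) (by linarith), ENNReal.ofReal_eq_zero] at hα
    exact le_antisymm hα h0

theorem ae_eq_zero_of_integral_exp_eq_zero {g : ℂ → ℂ} (hg : Integrable g)
    (h : ∀ t : ℂ, ∫ α, g α * Complex.exp ((inner ℝ α t : ℝ) * Complex.I) = 0) :
    g =ᵐ[volume] 0 := by
  have hexp : ∀ t : ℂ, Continuous fun α : ℂ => Complex.exp ((inner ℝ α t : ℝ) * Complex.I) :=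
    fun t => by fun_prop
  have hi : ∀ {f : ℂ → ℂ}, Integrable f → ∀ t : ℂ,
      Integrable fun α => f α * Complex.exp ((inner ℝ α t : ℝ) * Complex.I) := fun hf t =>
    hf.mul_bdd (c := 1) (hexp t).aestronglyMeasurable
      (ae_of_all _ fun α => (Complex.norm_exp_ofReal_mul_I _).le)
  have hconj : ∀ t : ℂ, ∫ α, conj (g α) * Complex.exp ((inner ℝ α t : ℝ) * Complex.I) = 0 := by
    intro t
    -- Conjugating the hypothesis at `-t` gives the same vanishing for the conjugate of `g`, which
    -- isolates the real and imaginary parts.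
    have h1 := congrArg conj (h (-t))
    rw [← integral_conj, map_zero] at h1
    rw [← h1]
    refine integral_congr_ae (ae_of_all _ fun α => ?_)
    beta_reduce
    rw [map_mul, ← Complex.exp_conj, map_mul, Complex.conj_I, Complex.conj_ofReal, inner_neg_right]
    push_cast
    ring_nf
  have hgc : Integrable fun α => conj (g α) :=
    (Complex.conjCLE : ℂ →L[ℝ] ℂ).integrable_comp hg
  have hre : (fun α => (g α).re) =ᵐ[volume] 0 := by
    refine ae_eq_zero_of_integral_exp_eq_zero_real hg.re fun t => ?_
    have h1 : ∫ α, (2 : ℂ)⁻¹ * (g α * Complex.exp ((inner ℝ α t : ℝ) * Complex.I)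
        + conj (g α) * Complex.exp ((inner ℝ α t : ℝ) * Complex.I)) = 0 := by
      rw [integral_const_mul, integral_add (hi hg t) (hi hgc t), h, hconj]
      simp
    rw [← h1]
    refine integral_congr_ae (ae_of_all _ fun α => ?_)
    simp only [Complex.re_eq_add_conj]
    ring
  have him : (fun α => (g α).im) =ᵐ[volume] 0 := by
    refine ae_eq_zero_of_integral_exp_eq_zero_real hg.im fun t => ?_
    have h1 : ∫ α, (2 * Complex.I : ℂ)⁻¹ * (g α * Complex.exp ((inner ℝ α t : ℝ) * Complex.I)
        - conj (g α) * Complex.exp ((inner ℝ α t : ℝ) * Complex.I)) = 0 := by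
      rw [integral_const_mul, integral_sub (hi hg t) (hi hgc t), h, hconj]
      simp
    rw [← h1]
    refine integral_congr_ae (ae_of_all _ fun α => ?_)
    simp only [Complex.im_eq_sub_conj]
    ring
  filter_upwards [hre, him] with α h1 h2
  exact Complex.ext h1 h2

/-- The functions `f` with `h f` integrable of vanishing integral. -/
def annihilatedBy (h : ℂ → ℂ) : Submodule ℂ (ℂ → ℂ) where
  carrier := {f | Integrable (fun α => h α * f α) ∧ ∫ α, h α * f α = 0}
  zero_mem' := by simp
  add_mem' := by
    rintro f g ⟨h1, h2⟩ ⟨h3, h4⟩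
    simp only [Set.mem_ofPred_eq, Pi.add_apply, mul_add]
    exact ⟨h1.add h3, by rw [integral_add h1 h3, h2, h4, add_zero]⟩
  smul_mem' := by
    rintro c f ⟨h1, h2⟩
    simp only [Set.mem_ofPred_eq, Pi.smul_apply, smul_eq_mul, mul_left_comm _ c]
    exact ⟨h1.const_mul c, by rw [integral_const_mul, h2, mul_zero]⟩

/-- The real inner product is `(t ᾱ + t̄ α) / 2`, and by the ladder recursions each factor `α` or
`ᾱ` turns a matrix element into a combination of its neighbours. -/
theorem inner_pow_mul_displacementElement_mem {h : ℂ → ℂ}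
    (h0 : ∀ m n, displacementElement m n ∈ annihilatedBy h) (t : ℂ) (k m n : ℕ) :
    (fun α => ((inner ℝ α t : ℝ) : ℂ) ^ k * displacementElement m n α) ∈ annihilatedBy h := by
  induction k generalizing m n with
  | zero => simpa using h0 m n
  | succ k ih =>
    have key : (fun α => ((inner ℝ α t : ℝ) : ℂ) ^ (k + 1) * displacementElement m n α)
        = (t / 2) • ((Real.sqrt m : ℂ) •
              (fun α => ((inner ℝ α t : ℝ) : ℂ) ^ k * displacementElement (m - 1) n α)
            - (Real.sqrt (n + 1) : ℂ) •
              (fun α => ((inner ℝ α t : ℝ) : ℂ) ^ k * displacementElement m (n + 1) α))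
          + (conj t / 2) • ((Real.sqrt (m + 1) : ℂ) •
              (fun α => ((inner ℝ α t : ℝ) : ℂ) ^ k * displacementElement (m + 1) n α)
            - (Real.sqrt n : ℂ) •
              (fun α => ((inner ℝ α t : ℝ) : ℂ) ^ k * displacementElement m (n - 1) α)) := by
      funext α
      have h1 : ((inner ℝ α t : ℝ) : ℂ) = t / 2 * conj α + conj t / 2 * α := by
        rw [Complex.inner, Complex.re_eq_add_conj]
        simp only [map_mul, Complex.conj_conj]
        ring
      simp only [Pi.add_apply, Pi.sub_apply, Pi.smul_apply, smul_eq_mul]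
      have e1 := mul_displacementElement m n α
      have e2 := conj_mul_displacementElement m n α
      generalize hx : ((inner ℝ α t : ℝ) : ℂ) = x at *
      rw [pow_succ]
      nth_rw 2 [h1]
      linear_combination (x ^ k * t / 2) * e2 + (x ^ k * conj t / 2) * e1
    rw [key]
    exact Submodule.add_mem _
      (Submodule.smul_mem _ _ (Submodule.sub_mem _ (Submodule.smul_mem _ _ (ih _ _))
        (Submodule.smul_mem _ _ (ih _ _))))
      (Submodule.smul_mem _ _ (Submodule.sub_mem _ (Submodule.smul_mem _ _ (ih _ _))
        (Submodule.smul_mem _ _ (ih _ _))))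

/-- The matrix elements of the displacement operators separate integrable functions. -/
theorem ae_eq_zero_of_integral_displacementElement {h : ℂ → ℂ} (hi : Integrable h)
    (h0 : ∀ m n, ∫ α, h α * displacementElement m n α = 0) : h =ᵐ[volume] 0 := by
  have hi' : ∀ m n, Integrable fun α => h α * displacementElement m n α := fun m n =>
    hi.mul_bdd (c := 1) (continuous_displacementElement m n).aestronglyMeasurable
      (ae_of_all _ fun α => norm_displacementElement_le m n α)
  have hmem : ∀ m n, displacementElement m n ∈ annihilatedBy h := fun m n => ⟨hi' m n, h0 m n⟩
  have hzero := ae_eq_zero_of_integral_exp_eq_zero (hi' 0 0) fun t => by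
    -- The exponential series of `exp(i⟨α, t⟩)` times `h` and the Gaussian, each term of which
    -- integrates to zero.
    let F : ℕ → ℂ → ℂ := fun k α => ((k.factorial : ℂ)⁻¹ * Complex.I ^ k) *
      (h α * (((inner ℝ α t : ℝ) : ℂ) ^ k * displacementElement 0 0 α))
    let bound : ℕ → ℂ → ℝ := fun k α => ‖h α * displacementElement 0 0 α‖ *
      ((k.factorial : ℝ)⁻¹ * (‖α‖ * ‖t‖) ^ k)
    have hF0 : ∀ k, ∫ α, F k α = 0 := fun k => by
      simp only [F]
      rw [integral_const_mul, (inner_pow_mul_displacementElement_mem hmem t k 0 0).2, mul_zero]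
    have hbs : ∀ α, HasSum (fun k => bound k α)
        (‖h α * displacementElement 0 0 α‖ * Real.exp (‖α‖ * ‖t‖)) := by
      intro α
      refine HasSum.mul_left _ ?_
      have := NormedSpace.exp_series_hasSum_exp' (𝕂 := ℝ) (‖α‖ * ‖t‖)
      rwa [← Real.exp_eq_exp_ℝ] at this
    have hsum : HasSum (fun k => ∫ α, F k α)
        (∫ α, h α * displacementElement 0 0 α * Complex.exp ((inner ℝ α t : ℝ) * Complex.I)) := by
      refine hasSum_integral_of_dominated_convergence bound (fun k => ?_) (fun k => ?_)
        (ae_of_all _ fun α => (hbs α).summable) ?_ (ae_of_all _ fun α => ?_)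
      · exact ((inner_pow_mul_displacementElement_mem hmem t k 0 0).1.const_mul _).1
      · refine ae_of_all _ fun α => ?_
        simp only [F, bound, norm_mul, norm_pow, norm_inv, Complex.norm_I, one_pow, mul_one,
          Complex.norm_natCast, Complex.norm_real]
        have h1 : ‖(inner ℝ α t : ℝ)‖ ≤ ‖α‖ * ‖t‖ := norm_inner_le_norm α t
        calc _ = ‖h α‖ * ‖displacementElement 0 0 α‖ *
              ((k.factorial : ℝ)⁻¹ * ‖(inner ℝ α t : ℝ)‖ ^ k) := by ring
          _ ≤ _ := by gcongr
      · simp only [(hbs _).tsum_eq]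
        -- The Gaussian absorbs the sum of the bounds: `-‖α‖²/2 + ‖α‖‖t‖ ≤ ‖t‖²/2`.
        refine Integrable.mono' (hi.norm.mul_const (Real.exp (‖t‖ ^ 2 / 2)))
          ((hi' 0 0).norm.1.mul (by fun_prop)) (ae_of_all _ fun α => ?_)
        rw [Real.norm_of_nonneg (by positivity), norm_mul, displacementElement_zero_zero,
          Complex.norm_real, Real.norm_of_nonneg (Real.exp_pos _).le, mul_assoc, ← Real.exp_add]
        gcongr
        nlinarith [sq_nonneg (‖α‖ - ‖t‖)]
      · have h1 := NormedSpace.exp_series_hasSum_exp' (𝕂 := ℂ) ((inner ℝ α t : ℝ) * Complex.I)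
        rw [← Complex.exp_eq_exp_ℂ] at h1
        refine (h1.mul_left (h α * displacementElement 0 0 α)).congr_fun fun k => ?_
        simp only [F, smul_eq_mul, mul_pow]
        ring
    simp only [hF0] at hsum
    exact hsum.unique hasSum_zero
  filter_upwards [hzero] with α hα
  have hne : displacementElement 0 0 α ≠ 0 := by
    rw [displacementElement_zero_zero]
    exact Complex.ofReal_ne_zero.2 (Real.exp_pos _).ne'
  exact (mul_eq_zero.1 hα).resolve_right hne

end FourierUniqueness

/-! ### A CPTP filtering map has a nonnegative kernel of integral one. -/

section Positivity

theorem hasTrace_rankOne {K : Type} [NormedAddCommGroup K] [InnerProductSpace ℂ K] (μ : K) :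
    HasTrace (InnerProductSpace.rankOne ℂ μ μ) ((‖μ‖ ^ 2 : ℝ) : ℂ) := by
  intro ι b
  have h := b.hasSum_inner_mul_inner μ μ
  rw [inner_self_eq_norm_sq_to_K] at h
  push_cast
  refine h.congr_fun fun i => ?_
  rw [InnerProductSpace.rankOne_apply, inner_smul_right]

theorem isDensityOperator_rankOne {K : Type} [NormedAddCommGroup K] [InnerProductSpace ℂ K]
    {μ : K} (hμ : ‖μ‖ = 1) : IsDensityOperator (InnerProductSpace.rankOne ℂ μ μ) := by
  refine ⟨InnerProductSpace.isPositive_rankOne_self μ, ?_⟩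
  simpa [hμ] using hasTrace_rankOne μ

theorem eq_of_block_eq {E : Type} [NormedAddCommGroup E] [InnerProductSpace ℂ E]
    {R T : JointSpace E →L[ℂ] JointSpace E} (h : ∀ e f, block R e f = block T e f) : R = T := by
  refine ContinuousLinearMap.ext_on
    (s := Set.range fun p : FockSpace × E => tensorRight p.2 p.1) ?_ ?_
  · rw [Submodule.dense_iff_topologicalClosure_eq_top]; exact span_tensorRight
  · rintro _ ⟨⟨y, f⟩, rfl⟩
    refine joint_ext_inner fun x e => ?_
    have := congrArg (fun S => ⟪x, S y⟫_ℂ) (h e f)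
    simpa only [block, ContinuousLinearMap.comp_apply, ContinuousLinearMap.adjoint_inner_right]
      using this

variable {Ω : FilterFunction}

/-- The positive operator supplied by complete positivity must be `jointFiltering Ω μ`, because
blocks determine an operator; its expectation at `ν` is the integral. -/
theorem IsCPTP.integral_norm_inner_nonneg_of_norm_eq_one (hΩ : IsCPTP (filteringMap Ω)) {E : Type}
    [NormedAddCommGroup E] [InnerProductSpace ℂ E] [CompleteSpace E] {μ : JointSpace E}
    (hμ : ‖μ‖ = 1) (ν : JointSpace E) :
    0 ≤ ∫ α, Ω.fourier α * ‖⟪ν, jointDisplacement α μ⟫_ℂ‖ ^ 2 := by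
  obtain ⟨R, hR, hRpos⟩ := hΩ.completely_positive E _ (isDensityOperator_rankOne hμ)
  have hRe : R = jointFiltering Ω μ :=
    eq_of_block_eq fun e f => (hR e f).trans (isAmpliation_jointFiltering Ω μ e f).symm
  have h1 : ⟪ν, R ν⟫_ℂ = ((∫ α, Ω.fourier α * ‖⟪ν, jointDisplacement α μ⟫_ℂ‖ ^ 2 : ℝ) : ℂ) := by
    rw [hRe, inner_jointFiltering, ← integral_complex_ofReal]
    refine integral_congr_ae (ae_of_all _ fun α => ?_)
    beta_reduce
    rw [← inner_conj_symm (jointDisplacement α μ) ν, Complex.mul_conj, Complex.normSq_eq_norm_sq]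
    push_cast
    rfl
  have h2 := hRpos.re_inner_nonneg_right ν
  rw [h1] at h2
  simpa using h2

theorem IsCPTP.integral_norm_inner_nonneg (hΩ : IsCPTP (filteringMap Ω)) {E : Type}
    [NormedAddCommGroup E] [InnerProductSpace ℂ E] [CompleteSpace E] (μ ν : JointSpace E) :
    0 ≤ ∫ α, Ω.fourier α * ‖⟪ν, jointDisplacement α μ⟫_ℂ‖ ^ 2 := by
  rcases eq_or_ne μ 0 with rfl | hμ
  · simp
  have hn : ‖((‖μ‖⁻¹ : ℝ) : ℂ) • μ‖ = 1 := by
    rw [norm_smul, Complex.norm_real, norm_inv, norm_norm, inv_mul_cancel₀ (norm_ne_zero_iff.2 hμ)]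
  have h := hΩ.integral_norm_inner_nonneg_of_norm_eq_one hn ν
  have h2 : ∀ α, Ω.fourier α * ‖⟪ν, jointDisplacement α (((‖μ‖⁻¹ : ℝ) : ℂ) • μ)⟫_ℂ‖ ^ 2
      = (‖μ‖⁻¹) ^ 2 * (Ω.fourier α * ‖⟪ν, jointDisplacement α μ⟫_ℂ‖ ^ 2) := fun α => by
    rw [_root_.map_smul, inner_smul_right, norm_mul, Complex.norm_real, norm_inv, norm_norm]
    ring
  simp only [h2] at h
  rw [integral_const_mul] at h
  exact nonneg_of_mul_nonneg_right h (by positivity)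

/-- Complete positivity is tested on entangled vectors whose environment parts are orthonormal
labels of the pairs: cross terms vanish, and the overlap is exactly the given combination of matrix
elements. -/
theorem IsCPTP.integral_norm_sum_nonneg (hΩ : IsCPTP (filteringMap Ω)) (s : Finset (ℕ × ℕ))
    (c : ℕ × ℕ → ℂ) :
    0 ≤ ∫ α, Ω.fourier α * ‖∑ p ∈ s, c p * displacementElement p.1 p.2 α‖ ^ 2 := by
  let e : ℕ × ℕ → FockSpace := fun p => numberState (Nat.pair p.1 p.2)
  have he : ∀ p q, ⟪e p, e q⟫_ℂ = if p = q then 1 else 0 := fun p q => by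
    simp only [e, inner_numberState, Nat.pair_eq_pair, Prod.ext_iff]
  have h := hΩ.integral_norm_inner_nonneg (∑ p ∈ s, tensorRight (e p) (numberState p.2))
    (∑ p ∈ s, tensorRight (e p) (conj (c p) • numberState p.1))
  convert h using 6 with α
  rw [map_sum, sum_inner]
  refine Finset.sum_congr rfl fun p hp => ?_
  rw [inner_sum, Finset.sum_eq_single p]
  · rw [jointDisplacement_tensorRight, inner_tensorRight, he, if_pos rfl, mul_one, inner_smul_left,
      Complex.conj_conj]
    rfl
  · intro q _ hq
    rw [jointDisplacement_tensorRight, inner_tensorRight, he, if_neg hq.symm, mul_zero]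
  · exact fun h => absurd hp h

/-- The trace of the filtered vacuum is `∫ Ω̃(α) ∑ₙ |⟨n|D(α)|0⟩|²`, and the inner sum is `1` by
Parseval. -/
theorem IsCPTP.integral_fourier (hΩ : IsCPTP (filteringMap Ω)) : ∫ α, Ω.fourier α = 1 := by
  have h1 := hΩ.trace_preserving _ _ (hasTrace_rankOne (numberState 0)) ℕ numberBasis
  rw [norm_numberState] at h1
  have hsum : ∀ α, HasSum (fun n => ‖displacementElement n 0 α‖ ^ 2) 1 := by
    intro α
    have h := Complex.hasSum_re (numberBasis.hasSum_inner_mul_inner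
      (displacement α (numberState 0)) (displacement α (numberState 0)))
    rw [inner_self_eq_norm_sq_to_K, norm_displacement, norm_numberState] at h
    simp only [RCLike.ofReal_one, one_pow, Complex.one_re, numberBasis_apply] at h
    refine h.congr_fun fun n => ?_
    rw [displacementElement, ← inner_conj_symm (displacement α _) (numberState n), mul_comm, Complex.mul_conj,
      Complex.normSq_eq_norm_sq, Complex.ofReal_re]
  have h2 : HasSum (fun n => ∫ α, Ω.fourier α * ‖displacementElement n 0 α‖ ^ 2)
      (∫ α, Ω.fourier α) := by
    refine hasSum_integral_of_dominated_convergence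
      (fun n α => ‖Ω.fourier α‖ * ‖displacementElement n 0 α‖ ^ 2) (fun n => ?_) (fun n => ?_)
      (ae_of_all _ fun α => ((hsum α).mul_left _).summable) ?_ (ae_of_all _ fun α => ?_)
    · exact Ω.integrable_fourier.1.mul
        ((continuous_displacementElement n 0).norm.pow 2).aestronglyMeasurable
    · exact ae_of_all _ fun α => by rw [norm_mul, norm_pow, norm_norm]
    · simp only [((hsum _).mul_left _).tsum_eq, mul_one]
      exact Ω.integrable_fourier.norm
    · simpa using (hsum α).mul_left (Ω.fourier α)
  have h3 : HasSum (fun n => ((∫ α, Ω.fourier α * ‖displacementElement n 0 α‖ ^ 2 : ℝ) : ℂ))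
      ((1 ^ 2 : ℝ) : ℂ) := by
    refine h1.congr_fun fun n => ?_
    rw [numberBasis_apply, inner_filteringMap_rankOne, ← integral_complex_ofReal]
    refine integral_congr_ae (ae_of_all _ fun α => ?_)
    beta_reduce
    rw [← inner_conj_symm (displacement α _) (numberState n), Complex.mul_conj,
      Complex.normSq_eq_norm_sq]
    push_cast
    rfl
  have h4 := h2.unique (Complex.hasSum_ofReal.1 h3)
  simpa using h4

theorem norm_sq_eq_integral {ν : Measure ℂ} (u : Lp ℂ 2 ν) : ‖u‖ ^ 2 = ∫ α, ‖u α‖ ^ 2 ∂ν := by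
  have h := inner_self_eq_norm_sq_to_K (𝕜 := ℂ) u
  rw [L2.inner_def] at h
  have h2 : ∫ α, ⟪u α, u α⟫_ℂ ∂ν = ((∫ α, ‖u α‖ ^ 2 ∂ν : ℝ) : ℂ) := by
    rw [← integral_complex_ofReal]
    refine integral_congr_ae (ae_of_all _ fun α => ?_)
    simp only [inner_self_eq_norm_sq_to_K]
    push_cast
    rfl
  rw [h2] at h
  refine (Complex.ofReal_injective ?_).symm
  rw [h]
  push_cast
  rfl

theorem Lp_coeFn_finsetSum {ι : Type*} (s : Finset ι) (F : ι → Lp ℂ 2 (volume : Measure ℂ)) :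
    (∑ i ∈ s, F i : Lp ℂ 2 (volume : Measure ℂ)) =ᵐ[volume] fun α => ∑ i ∈ s, F i α := by
  classical
  induction s using Finset.induction_on with
  | empty => simp only [Finset.sum_empty]; exact Lp.coeFn_zero ℂ 2 (volume : Measure ℂ)
  | insert i s hi ih =>
    rw [Finset.sum_insert hi]
    filter_upwards [Lp.coeFn_add (F i) (∑ i ∈ s, F i), ih] with α h1 h2
    rw [h1, Pi.add_apply, h2, Finset.sum_insert hi]

/-- With `w = √|g|`, the form `∫ g |f|²` is a continuous function of `w f` in `L²`. It is
nonnegative on the span of the `w ⟨m|D|n⟩`, hence on the closure. That closure contains `w` times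
the indicator of `{g < 0}`, where the form equals minus the integral of the negative part of `g`. -/
theorem nonneg_of_integral_norm_sum_nonneg {g : ℂ → ℝ} (hg : Integrable g) (hgm : Measurable g)
    (hpos : ∀ (s : Finset (ℕ × ℕ)) (c : ℕ × ℕ → ℂ),
      0 ≤ ∫ α, g α * ‖∑ p ∈ s, c p * displacementElement p.1 p.2 α‖ ^ 2) :
    0 ≤ᵐ[volume] g := by
  let w : ℂ → ℝ := fun α => Real.sqrt |g α|
  have hwm : Measurable w := hgm.abs.sqrt
  have hw2 : ∀ α, w α ^ 2 = |g α| := fun α => Real.sq_sqrt (abs_nonneg _)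
  have hmem : ∀ {f : ℂ → ℂ}, Measurable f → (∀ α, ‖f α‖ ≤ 1) →
      MemLp (fun α => (w α : ℂ) * f α) 2 volume := by
    intro f hf hf1
    have hm : Measurable fun α => (w α : ℂ) * f α := (Complex.measurable_ofReal.comp hwm).mul hf
    rw [memLp_two_iff_integrable_sq_norm hm.aestronglyMeasurable]
    refine Integrable.mono' hg.norm (hm.norm.pow_const 2).aestronglyMeasurable
      (ae_of_all _ fun α => ?_)
    rw [norm_mul, Complex.norm_real, mul_pow, norm_mul, norm_pow, norm_norm, norm_pow, norm_norm,
      ← norm_pow, hw2, Real.norm_eq_abs, abs_abs, Real.norm_eq_abs]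
    exact mul_le_of_le_one_right (abs_nonneg _) (pow_le_one₀ (norm_nonneg _) (hf1 α))
  let N : Set ℂ := {α | g α < 0}
  have hN : MeasurableSet N := measurableSet_lt hgm measurable_const
  have hφ : ∀ p : ℕ × ℕ, MemLp (fun α => (w α : ℂ) * displacementElement p.1 p.2 α) 2 volume :=
    fun p => hmem (continuous_displacementElement _ _).measurable
      (norm_displacementElement_le _ _)
  have hu : MemLp (fun α => (w α : ℂ) * N.indicator 1 α) 2 volume := by
    refine hmem (measurable_one.indicator hN) fun α => ?_
    by_cases h : α ∈ N <;> simp [h]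
  let Φ : ℕ × ℕ → Lp ℂ 2 (volume : Measure ℂ) := fun p => (hφ p).toLp _
  let u₀ : Lp ℂ 2 (volume : Measure ℂ) := hu.toLp _
  let K : Submodule ℂ (Lp ℂ 2 (volume : Measure ℂ)) := Submodule.span ℂ (Set.range Φ)
  -- If `f` is orthogonal to the span, the integrable function `f̄ w` is annihilated by every matrix
  -- element, so it vanishes almost everywhere and `f` is orthogonal to `u₀`.
  have hclos : u₀ ∈ K.topologicalClosure := by
    rw [← Submodule.orthogonal_orthogonal_eq_closure, Submodule.mem_orthogonal]
    intro f hf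
    rw [Submodule.mem_orthogonal'] at hf
    have hwL : MemLp (fun α => (w α : ℂ)) 2 volume := by
      simpa using hmem (f := fun _ => 1) measurable_const (by simp)
    have hfL : MemLp (fun α => conj (f α)) 2 volume := (Lp.memLp f).star
    have hint : Integrable fun α => conj (f α) * (w α : ℂ) := hfL.integrable_mul hwL
    have h0 := ae_eq_zero_of_integral_displacementElement hint fun m n => by
      have h1 := hf _ (Submodule.subset_span ⟨(m, n), rfl⟩)
      rw [L2.inner_def] at h1
      rw [← h1]
      refine integral_congr_ae ?_
      filter_upwards [(hφ (m, n)).coeFn_toLp] with α hα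
      simp only [Φ, hα, RCLike.inner_apply]
      ring
    rw [L2.inner_def]
    refine integral_eq_zero_of_ae ?_
    filter_upwards [hu.coeFn_toLp, h0] with α h1 h2
    have h3 : conj (f α) * (w α : ℂ) = 0 := h2
    simp only [u₀, h1, RCLike.inner_apply, Pi.zero_apply]
    linear_combination N.indicator (1 : ℂ → ℂ) α * h3
  let Q : Lp ℂ 2 (volume : Measure ℂ) → ℝ := fun u =>
    ‖LpToLpRestrictCLM ℂ ℂ ℂ volume 2 Nᶜ u‖ ^ 2 - ‖LpToLpRestrictCLM ℂ ℂ ℂ volume 2 N u‖ ^ 2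
  have hQc : Continuous Q := by fun_prop
  have hQ : ∀ (u : Lp ℂ 2 (volume : Measure ℂ)) (f : ℂ → ℂ),
      (u =ᵐ[volume] fun α => (w α : ℂ) * f α) → Q u = ∫ α, g α * ‖f α‖ ^ 2 := by
    intro u f huf
    have hr : ∀ s : Set ℂ, ‖LpToLpRestrictCLM ℂ ℂ ℂ volume 2 s u‖ ^ 2
        = ∫ α in s, |g α| * ‖f α‖ ^ 2 := by
      intro s
      rw [norm_sq_eq_integral]
      refine integral_congr_ae ?_
      filter_upwards [LpToLpRestrictCLM_coeFn ℂ s u, ae_restrict_of_ae huf] with α h1 h2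
      rw [h1, h2, norm_mul, Complex.norm_real, mul_pow, ← norm_pow, hw2, Real.norm_eq_abs, abs_abs]
    have hI : Integrable fun α => |g α| * ‖f α‖ ^ 2 := by
      refine ((memLp_two_iff_integrable_sq_norm (Lp.memLp u).1).1 (Lp.memLp u)).congr ?_
      filter_upwards [huf] with α h2
      rw [h2, norm_mul, Complex.norm_real, mul_pow, ← norm_pow, hw2, Real.norm_eq_abs, abs_abs]
    have hI' : Integrable fun α => g α * ‖f α‖ ^ 2 := by
      -- Only `w f` is known to be measurable, not `f`; writing `g = sign g · |g|` recovers
      -- measurability from `|g| ‖f‖²`.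
      have hfm : AEStronglyMeasurable (fun α => g α * ‖f α‖ ^ 2) volume := by
        have : (fun α => g α * ‖f α‖ ^ 2) = fun α => SignType.sign (g α) * (|g α| * ‖f α‖ ^ 2) := by
          funext α
          rw [← mul_assoc, sign_mul_abs]
        rw [this]
        refine AEStronglyMeasurable.mul ?_ hI.1
        have hs : (fun α => ((SignType.sign (g α) : SignType) : ℝ))
            = fun α => (if 0 < g α then 1 else if g α < 0 then -1 else 0) := by
          funext α
          rw [sign_apply]
          split_ifs <;> simp
        rw [hs]
        exact (Measurable.ite (measurableSet_lt measurable_const hgm) measurable_const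
          (Measurable.ite hN measurable_const measurable_const)).aestronglyMeasurable
      refine hI.mono hfm (ae_of_all _ fun α => ?_)
      rw [norm_mul, norm_mul]
      simp
    simp only [Q]
    rw [hr, hr, ← integral_add_compl hN hI', sub_eq_neg_add, ← integral_neg]
    congr 1
    · refine setIntegral_congr_fun hN fun α (hα : g α < 0) => ?_
      rw [abs_of_neg hα]; ring
    · refine setIntegral_congr_fun hN.compl fun α (hα : ¬ g α < 0) => ?_
      rw [abs_of_nonneg (not_lt.1 hα)]
  have hKQ : ∀ u ∈ K, 0 ≤ Q u := by
    intro u huK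
    obtain ⟨c, hc⟩ := (Finsupp.mem_span_range_iff_exists_finsupp).1 huK
    rw [hQ u fun α => ∑ p ∈ c.support, c p * displacementElement p.1 p.2 α]
    · exact hpos _ _
    · rw [← hc, Finsupp.sum]
      have h1 : ∀ p ∈ c.support, (c p • Φ p : Lp ℂ 2 (volume : Measure ℂ)) =ᵐ[volume]
          fun α => (w α : ℂ) * (c p * displacementElement p.1 p.2 α) := by
        intro p _
        filter_upwards [Lp.coeFn_smul (c p) (Φ p), (hφ p).coeFn_toLp] with α h1 h2
        rw [h1, Pi.smul_apply, h2, smul_eq_mul]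
        ring
      have h2 := (ae_ball_iff (Finset.countable_toSet c.support)).2 h1
      filter_upwards [Lp_coeFn_finsetSum c.support (fun p => c p • Φ p), h2] with α h3 h4
      rw [h3, Finset.mul_sum]
      exact Finset.sum_congr rfl fun p hp => h4 p hp
  have hQ0 : 0 ≤ Q u₀ :=
    closure_minimal (s := (K : Set (Lp ℂ 2 (volume : Measure ℂ)))) (t := {u | 0 ≤ Q u}) hKQ
      (isClosed_le continuous_const hQc) hclos
  rw [hQ u₀ (N.indicator 1) hu.coeFn_toLp] at hQ0
  have hneg : ∀ α, g α * ‖N.indicator (1 : ℂ → ℂ) α‖ ^ 2 = -(max (-g α) 0) := by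
    intro α
    by_cases h : α ∈ N
    · have h' : g α < 0 := h
      simp [h, max_eq_left (show 0 ≤ -g α by linarith)]
    · have h' : 0 ≤ g α := not_lt.1 h
      simp [h, max_eq_right (show -g α ≤ 0 by linarith)]
  simp only [hneg] at hQ0
  rw [integral_neg] at hQ0
  have h5 : ∫ α, max (-g α) 0 = 0 :=
    le_antisymm (by linarith) (integral_nonneg fun α => le_max_right _ _)
  have h6 := (integral_eq_zero_iff_of_nonneg (f := fun α => max (-g α) 0)
    (fun α => le_max_right _ _) hg.neg.pos_part).1 h5
  filter_upwards [h6] with α hα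
  have : max (-g α) 0 = 0 := hα
  have := le_max_left (-g α) 0
  simp only [Pi.zero_apply]
  linarith

/-- A completely positive filtering map has a nonnegative kernel. -/
theorem IsCPTP.fourier_nonneg (hΩ : IsCPTP (filteringMap Ω)) : 0 ≤ᵐ[volume] Ω.fourier := by
  have hae := Ω.integrable_fourier.1.ae_eq_mk
  have h := nonneg_of_integral_norm_sum_nonneg (Ω.integrable_fourier.congr hae)
    Ω.integrable_fourier.1.stronglyMeasurable_mk.measurable fun s c => by
      refine (hΩ.integral_norm_sum_nonneg s c).trans_eq (integral_congr_ae ?_)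
      filter_upwards [hae] with α hα
      rw [hα]
  filter_upwards [h, hae] with α h1 h2
  rwa [h2]

end Positivity

/-! ### The fidelity bound and the pure case. -/

section Fidelity

theorem memLp_smul_of_bounded {V : Type*} [NormedAddCommGroup V] [NormedSpace ℂ V] {a : ℂ → ℂ}
    (ha : MemLp a 2 volume) {F : ℂ → V} {C : ℝ} (hF : Continuous F) (hC : ∀ α, ‖F α‖ ≤ C) :
    MemLp (fun α => a α • F α) 2 volume := by
  refine ha.of_le_mul (c := C) (ha.1.smul hF.aestronglyMeasurable) (ae_of_all _ fun α => ?_)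
  rw [norm_smul, mul_comm]
  gcongr
  exact hC α

theorem inner_toLp_smul {V : Type*} [NormedAddCommGroup V] [InnerProductSpace ℂ V] {a b : ℂ → ℂ}
    {F G : ℂ → V} (hF : MemLp (fun α => a α • F α) 2 volume)
    (hG : MemLp (fun α => b α • G α) 2 volume) :
    ⟪hF.toLp, hG.toLp⟫_ℂ = ∫ α, conj (a α) * b α * ⟪F α, G α⟫_ℂ := by
  rw [L2.inner_def]
  refine integral_congr_ae ?_
  filter_upwards [hF.coeFn_toLp, hG.coeFn_toLp] with α h1 h2
  rw [h1, h2, inner_smul_left, inner_smul_right, mul_assoc]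

variable {Ω : FilterFunction} {ρ σ : FockSpace →L[ℂ] FockSpace}

theorem purificationOverlaps_nonneg {r : ℝ} (hr : r ∈ purificationOverlaps ρ σ) : 0 ≤ r := by
  obtain ⟨E, _, _, _, μ, ν, -, -, rfl⟩ := hr
  positivity

theorem bddAbove_purificationOverlaps (hρ : HasTrace ρ 1) (hσ : HasTrace σ 1) :
    BddAbove (purificationOverlaps ρ σ) := by
  refine ⟨1, ?_⟩
  rintro r ⟨E, _, _, _, μ, ν, hμ, hν, rfl⟩
  refine pow_le_one₀ (norm_nonneg _) ((norm_inner_le_norm _ _).trans ?_)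
  rw [hμ.norm_eq_one hρ, hν.norm_eq_one hσ, one_mul]

theorem fidelity_nonneg : 0 ≤ fidelity ρ σ :=
  Real.sSup_nonneg fun _ hr => purificationOverlaps_nonneg hr

theorem IsCPTP.filterOverlap_nonneg (hΩ : IsCPTP (filteringMap Ω)) : 0 ≤ filterOverlap Ω ρ := by
  refine integral_nonneg_of_ae ?_
  filter_upwards [hΩ.fourier_nonneg] with α hα
  exact mul_nonneg hα (by positivity)

theorem norm_adjoint_tensorLeft_le {E : Type} [NormedAddCommGroup E] [InnerProductSpace ℂ E]
    [CompleteSpace E] (x : FockSpace) (μ : JointSpace E) (α : ℂ) :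
    ‖ContinuousLinearMap.adjoint (tensorLeft x) (jointDisplacement α μ)‖
      ≤ ‖ContinuousLinearMap.adjoint (tensorLeft (E := E) x)‖ * ‖μ‖ := by
  refine (ContinuousLinearMap.le_opNorm _ _).trans ?_
  gcongr
  exact norm_jointDisplacement_le α μ

theorem hasSum_norm_sq_adjoint_tensorLeft {E : Type} [NormedAddCommGroup E]
    [InnerProductSpace ℂ E] [CompleteSpace E] (μ : JointSpace E) :
    HasSum (fun n => ‖ContinuousLinearMap.adjoint (tensorLeft (numberState n)) μ‖ ^ 2)
      (‖μ‖ ^ 2) := by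
  have h := hasSum_inner_adjoint_tensorLeft μ μ
  simp only [inner_self_eq_norm_sq_to_K] at h
  refine Complex.hasSum_ofReal.1 ?_
  push_cast
  exact h

/-- The entanglement fidelity is the squared overlap of two purifications. -/
theorem IsCPTP.filterOverlap_mem (hΩ : IsCPTP (filteringMap Ω)) (hρ : IsDensityOperator ρ)
    (hpos : 0 < filterOverlap Ω ρ) :
    filterOverlap Ω ρ ∈ purificationOverlaps ρ (filteringMap Ω ρ) := by
  obtain ⟨μ, hμ⟩ := exists_isPurification hρ
  set c := filterOverlap Ω ρ with hc
  let w : ℂ → ℂ := fun α => ((Real.sqrt |Ω.fourier α| : ℝ) : ℂ)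
  have hww : ∀ α, w α * w α = (|Ω.fourier α| : ℝ) := fun α => by
    simp only [w]
    rw [← Complex.ofReal_mul, Real.mul_self_sqrt (abs_nonneg _)]
  have hwconj : ∀ α, conj (w α) = w α := fun α => Complex.conj_ofReal _
  have hfa : ∀ᵐ α, |Ω.fourier α| = Ω.fourier α := by
    filter_upwards [hΩ.fourier_nonneg] with α hα using abs_of_nonneg hα
  have hw : MemLp w 2 volume := by
    have hm : AEStronglyMeasurable w volume :=
      Complex.continuous_ofReal.comp_aestronglyMeasurable (Real.continuous_sqrt.comp_aestronglyMeasurable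
        (continuous_abs.comp_aestronglyMeasurable Ω.integrable_fourier.1))
    rw [memLp_two_iff_integrable_sq_norm hm]
    refine Ω.integrable_fourier.norm.congr (ae_of_all _ fun α => ?_)
    simp only [w, Complex.norm_real, Real.norm_eq_abs, sq_abs, Real.sq_sqrt (abs_nonneg _)]
  let Φ : ℂ → ℂ := characteristicFunction ρ
  have hΦc : Continuous Φ := continuous_characteristicFunction hρ
  -- By Cauchy–Schwarz, the environment function proportional to `√Ω̃ Φ` maximises the overlap of `μ
  -- ⊗ a` with `√Ω̃ (D ⊗ 1)μ`; the factor `1/√c` gives it norm one.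
  let a : ℂ → ℂ := fun α => w α • (((Real.sqrt c)⁻¹ : ℝ) * Φ α)
  have ha : MemLp a 2 volume := by
    refine memLp_smul_of_bounded (C := (Real.sqrt c)⁻¹) hw (continuous_const.mul hΦc) fun α => ?_
    rw [norm_mul, Complex.norm_real, Real.norm_of_nonneg (by positivity)]
    exact mul_le_of_le_one_right (by positivity) (norm_characteristicFunction_le hρ α)
  let X : ℕ → FockSpace := fun n => ContinuousLinearMap.adjoint (tensorLeft (numberState n)) μ
  let Y : ℕ → ℂ → FockSpace := fun n α =>
    ContinuousLinearMap.adjoint (tensorLeft (numberState n)) (jointDisplacement α μ)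
  have hYc : ∀ n, Continuous (Y n) := fun n =>
    (ContinuousLinearMap.continuous _).comp (continuous_jointDisplacement μ)
  have h₁ : ∀ n, MemLp (fun α => a α • X n) 2 volume := fun n =>
    memLp_smul_of_bounded ha (continuous_const (y := X n)) fun _ => le_rfl
  have h₂ : ∀ n, MemLp (fun α => w α • Y n α) 2 volume := fun n =>
    memLp_smul_of_bounded hw (hYc n) (norm_adjoint_tensorLeft_le _ μ)
  have haa : ∫ α, conj (a α) * a α = 1 := by
    have e : ∫ α, conj (a α) * a α = (((c⁻¹ * c : ℝ)) : ℂ) := by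
      nth_rw 2 [hc]
      rw [filterOverlap, ← integral_const_mul, ← integral_complex_ofReal]
      refine integral_congr_ae ?_
      filter_upwards [hfa] with α hα
      have h3 : ((Real.sqrt c)⁻¹ : ℝ) * ((Real.sqrt c)⁻¹ : ℝ) = c⁻¹ := by
        rw [← mul_inv, Real.mul_self_sqrt hpos.le]
      have h4 : conj (Φ α) * Φ α = ((‖Φ α‖ ^ 2 : ℝ) : ℂ) := by
        rw [mul_comm, Complex.mul_conj, Complex.normSq_eq_norm_sq]
      simp only [a, smul_eq_mul, map_mul, Complex.conj_ofReal, hwconj]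
      rw [← h3, ← hα, Complex.ofReal_mul, Complex.ofReal_mul, Complex.ofReal_mul, ← h4, ← hww]
      ring
    rw [e, inv_mul_cancel₀ hpos.ne', Complex.ofReal_one]
  -- Both purifications have environment `L²(ℂ; FockSpace)`. The first has slices `a · X n`, whose
  -- Gram matrix is that of `μ` because `a` is a unit vector.
  obtain ⟨μ₁, hμ₁, hX⟩ := exists_isPurification_of_gram (η := fun n => (h₁ n).toLp)
    (fun x y => hρ.1.isSymmetric x y) hρ.2 fun m n => by
      rw [inner_toLp_smul, integral_mul_const, haa, one_mul]
      exact isPurification_iff.1 hμ _ _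
  -- The slices `√Ω̃ · Y n` have as Gram matrix the integral defining the filtered state, because
  -- `Ω̃ = |Ω̃|` almost everywhere.
  obtain ⟨μ₂, hμ₂, hY⟩ := exists_isPurification_of_gram (η := fun n => (h₂ n).toLp)
    (inner_filteringMap_symm Ω hρ) (hΩ.trace_preserving _ _ hρ.2) fun m n => by
      rw [inner_toLp_smul, inner_filteringMap Ω (integrable_filteringIntegrand Ω hρ)]
      refine integral_congr_ae ?_
      filter_upwards [hfa] with α hα
      rw [hwconj, hww, hα]
      simp only [Y, adjoint_tensorLeft_jointDisplacement]
      rw [isPurification_iff.1 hμ]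
  have hov : ⟪μ₁, μ₂⟫_ℂ = ((Real.sqrt c : ℝ) : ℂ) := by
    have hs1 := hasSum_inner_adjoint_tensorLeft μ₁ μ₂
    simp only [hX, hY, inner_toLp_smul] at hs1
    -- The bound `|⟨X, Y⟩| ≤ (‖X‖² + ‖Y‖²)/2` is summable over `n` by Parseval, which allows the
    -- slice sum and the integral to be exchanged.
    let bound : ℕ → ℂ → ℝ := fun n α => ‖conj (a α) * w α‖ *
      (2⁻¹ * (‖X n‖ ^ 2 + ‖Y n α‖ ^ 2))
    have hb : ∀ α, HasSum (fun n => bound n α)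
        (‖conj (a α) * w α‖ * (2⁻¹ * (‖μ‖ ^ 2 + ‖jointDisplacement α μ‖ ^ 2))) := fun α =>
      (((hasSum_norm_sq_adjoint_tensorLeft μ).add
        (hasSum_norm_sq_adjoint_tensorLeft (jointDisplacement α μ))).mul_left _).mul_left _
    have haw : Integrable fun α => conj (a α) * w α := ha.star.integrable_mul hw
    have hs2 : HasSum (fun n => ∫ α, conj (a α) * w α * ⟪X n, Y n α⟫_ℂ)
        (∫ α, conj (a α) * w α * ⟪μ, jointDisplacement α μ⟫_ℂ) := by
      refine hasSum_integral_of_dominated_convergence bound (fun n => ?_) (fun n => ?_)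
        (ae_of_all _ fun α => (hb α).summable) ?_ (ae_of_all _ fun α => ?_)
      · exact haw.1.mul (continuous_const.inner (hYc n)).aestronglyMeasurable
      · refine ae_of_all _ fun α => ?_
        rw [norm_mul]
        simp only [bound]
        gcongr
        refine (norm_inner_le_norm _ _).trans ?_
        nlinarith [sq_nonneg (‖X n‖ - ‖Y n α‖)]
      · simp only [(hb _).tsum_eq]
        refine haw.norm.mul_bdd (c := ‖μ‖ ^ 2) ?_ (ae_of_all _ fun α => ?_)
        · exact (continuous_const.mul (continuous_const.add
            ((continuous_jointDisplacement μ).norm.pow 2))).aestronglyMeasurable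
        · rw [Real.norm_of_nonneg (by positivity)]
          have := pow_le_pow_left₀ (norm_nonneg _) (norm_jointDisplacement_le α μ) 2
          linarith
      · exact (hasSum_inner_adjoint_tensorLeft μ (jointDisplacement α μ)).mul_left _
    rw [hs1.unique hs2]
    have e : ∫ α, conj (a α) * w α * ⟪μ, jointDisplacement α μ⟫_ℂ
        = ((((Real.sqrt c)⁻¹ * c : ℝ)) : ℂ) := by
      nth_rw 2 [hc]
      rw [filterOverlap, ← integral_const_mul, ← integral_complex_ofReal]
      refine integral_congr_ae ?_
      filter_upwards [hfa] with α hα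
      have h4 : conj (Φ α) * Φ α = ((‖Φ α‖ ^ 2 : ℝ) : ℂ) := by
        rw [mul_comm, Complex.mul_conj, Complex.normSq_eq_norm_sq]
      rw [← characteristicFunction_eq_inner hμ]
      simp only [a, smul_eq_mul, map_mul, Complex.conj_ofReal, hwconj]
      rw [← hα, Complex.ofReal_mul, Complex.ofReal_mul, ← h4, ← hww]
      ring
    rw [e]
    congr 1
    rw [inv_mul_eq_div, Real.div_sqrt]
  refine ⟨Lp FockSpace 2 (volume : Measure ℂ), inferInstance, inferInstance, inferInstance, μ₁, μ₂,
    hμ₁, hμ₂, ?_⟩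
  rw [hov, Complex.norm_real, Real.norm_of_nonneg (Real.sqrt_nonneg _), Real.sq_sqrt hpos.le]

/-- The value zero is treated apart, since the normalisation of the optimal vector divides by its
square root. -/
theorem IsCPTP.filterOverlap_le_fidelity (hΩ : IsCPTP (filteringMap Ω))
    (hρ : IsDensityOperator ρ) : filterOverlap Ω ρ ≤ fidelity ρ (filteringMap Ω ρ) := by
  rcases hΩ.filterOverlap_nonneg (ρ := ρ) |>.eq_or_lt with h | h
  · rw [← h]; exact fidelity_nonneg
  · exact le_csSup (bddAbove_purificationOverlaps hρ.2 (hΩ.trace_preserving _ _ hρ.2))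
      (hΩ.filterOverlap_mem hρ h)

theorem characteristicFunction_rankOne (ψ : FockSpace) (α : ℂ) :
    characteristicFunction (InnerProductSpace.rankOne ℂ ψ ψ) α = ⟪ψ, displacement α ψ⟫_ℂ := by
  rw [characteristicFunction, ← ContinuousLinearMap.adjoint_inner_left,
    ← numberBasis.tsum_inner_mul_inner]
  refine tsum_congr fun n => ?_
  rw [ContinuousLinearMap.comp_apply, InnerProductSpace.rankOne_apply, inner_smul_right,
    numberBasis_apply, ContinuousLinearMap.adjoint_inner_left]

theorem inner_filteringMap_pure (Ω : FilterFunction) (ψ : FockSpace) :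
    ⟪ψ, filteringMap Ω (InnerProductSpace.rankOne ℂ ψ ψ) ψ⟫_ℂ
      = (filterOverlap Ω (InnerProductSpace.rankOne ℂ ψ ψ) : ℂ) := by
  rw [inner_filteringMap_rankOne, filterOverlap, ← integral_complex_ofReal]
  refine integral_congr_ae (ae_of_all _ fun α => ?_)
  simp only [characteristicFunction_rankOne]
  rw [← inner_conj_symm (displacement α ψ) ψ, Complex.mul_conj, Complex.normSq_eq_norm_sq]
  push_cast
  rfl

/-- A purification of a pure state is a product vector. -/
theorem IsPurification.eq_tensorRight {E : Type} [NormedAddCommGroup E] [InnerProductSpace ℂ E]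
    [CompleteSpace E] {ψ : FockSpace} (hψ : ‖ψ‖ = 1) {μ : JointSpace E}
    (hμ : IsPurification μ (InnerProductSpace.rankOne ℂ ψ ψ)) :
    ∃ e : E, ‖e‖ = 1 ∧ μ = tensorRight e ψ := by
  have hin : ∀ x y, ⟪ContinuousLinearMap.adjoint (tensorLeft y) μ,
      ContinuousLinearMap.adjoint (tensorLeft x) μ⟫_ℂ = ⟪ψ, y⟫_ℂ * ⟪x, ψ⟫_ℂ := fun x y => by
    rw [isPurification_iff.1 hμ, InnerProductSpace.rankOne_apply, inner_smul_right]
  have hψψ : ⟪ψ, ψ⟫_ℂ = 1 := by rw [inner_self_eq_norm_sq_to_K, hψ]; simp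
  let e := ContinuousLinearMap.adjoint (tensorLeft ψ) μ
  have hx : ∀ x, ContinuousLinearMap.adjoint (tensorLeft x) μ = ⟪x, ψ⟫_ℂ • e := by
    intro x
    -- The Gram matrix of the slices has rank one, so the squared norm of the difference expands to
    -- zero.
    rw [← sub_eq_zero, ← inner_self_eq_zero (𝕜 := ℂ)]
    simp only [e, inner_sub_left, inner_sub_right, inner_smul_left, inner_smul_right, hin, hψψ,
      inner_conj_symm]
    ring
  refine ⟨e, ?_, joint_ext_inner fun x f => ?_⟩
  · have h1 := inner_self_eq_norm_sq_to_K (𝕜 := ℂ) e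
    simp only [e, hin, hψψ, mul_one] at h1
    have h2 : ‖e‖ ^ 2 = 1 := Complex.ofReal_injective (by simpa [e] using h1.symm)
    nlinarith [norm_nonneg e]
  · rw [← tensorLeft_apply, ← ContinuousLinearMap.adjoint_inner_right, hx, tensorLeft_apply,
      inner_tensorRight, inner_smul_right]

/-- Against a product vector `ψ ⊗ e` the overlap with `ν` is `⟨e, (⟨ψ| ⊗ 1)ν⟩`. By Cauchy–Schwarz
its square is at most the squared norm of that slice, which is `⟨ψ|ρ_Ω|ψ⟩`. -/
theorem IsCPTP.fidelity_pure (hΩ : IsCPTP (filteringMap Ω)) {ψ : FockSpace} (hψ : ‖ψ‖ = 1) :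
    fidelity (InnerProductSpace.rankOne ℂ ψ ψ)
      (filteringMap Ω (InnerProductSpace.rankOne ℂ ψ ψ))
        = filterOverlap Ω (InnerProductSpace.rankOne ℂ ψ ψ) := by
  refine le_antisymm ?_ (hΩ.filterOverlap_le_fidelity (isDensityOperator_rankOne hψ))
  refine Real.sSup_le ?_ hΩ.filterOverlap_nonneg
  rintro r ⟨E, _, _, _, μ, ν, hμ, hν, rfl⟩
  obtain ⟨e, he, rfl⟩ := hμ.eq_tensorRight hψ
  have h1 := isPurification_iff.1 hν ψ ψ
  rw [inner_filteringMap_pure, inner_self_eq_norm_sq_to_K] at h1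
  have h2 : ‖ContinuousLinearMap.adjoint (tensorLeft ψ) ν‖ ^ 2
      = filterOverlap Ω (InnerProductSpace.rankOne ℂ ψ ψ) :=
    Complex.ofReal_injective (by rw [← h1]; push_cast; rfl)
  rw [← h2, ← tensorLeft_apply, ← ContinuousLinearMap.adjoint_inner_right]
  gcongr
  refine (norm_inner_le_norm _ _).trans ?_
  rw [he, one_mul]

end Fidelity

/-! ### The limit of kernels tending to the delta distribution. -/

section Limit

/-- `|Φ|²` need not be an admissible test function. Nonnegativity and unit mass of the kernels give
the upper bound `1`, and for the lower bound it suffices to place a scaled bump function below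
`|Φ|²`. -/
theorem tendsto_filterOverlap {Ω : ℝ → FilterFunction}
    (hΩ : ∀ L : ℝ, 0 < L → IsCPTP (filteringMap (Ω L)))
    (hδ : TendstoDelta fun L => (Ω L).fourier) {ρ : FockSpace →L[ℂ] FockSpace}
    (hρ : IsDensityOperator ρ) : Tendsto (fun L => filterOverlap (Ω L) ρ) atTop (𝓝 1) := by
  have hq1 : ∀ α, ‖characteristicFunction ρ α‖ ^ 2 ≤ 1 := fun α =>
    pow_le_one₀ (norm_nonneg _) (norm_characteristicFunction_le hρ α)
  have hle : ∀ᶠ L in atTop, filterOverlap (Ω L) ρ ≤ 1 := by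
    filter_upwards [eventually_gt_atTop 0] with L hL
    rw [← (hΩ L hL).integral_fourier]
    refine integral_mono_ae (integrable_filterOverlap _ hρ) (Ω L).integrable_fourier ?_
    filter_upwards [(hΩ L hL).fourier_nonneg] with α hα
    exact mul_le_of_le_one_right hα (hq1 α)
  rw [tendsto_order]
  refine ⟨fun b hb => ?_, fun b hb => hle.mono fun L hL => hL.trans_lt hb⟩
  -- One factor `1 - ε` bounds `|Φ|²` below near `0`, the other bounds the integral against the
  -- bump. For `ε ≤ (1 - b)/4` the product is at least `1 - 2ε > b`.
  obtain ⟨ε, hε, hε1, hbε⟩ : ∃ ε : ℝ, 0 < ε ∧ ε < 1 ∧ b < (1 - ε) * (1 - ε) := by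
    refine ⟨min ((1 - b) / 4) 2⁻¹, lt_min (by linarith) (by norm_num),
      (min_le_right _ _).trans_lt (by norm_num), ?_⟩
    have h1 := min_le_left ((1 - b) / 4) (2⁻¹ : ℝ)
    nlinarith [sq_nonneg (min ((1 - b) / 4) (2⁻¹ : ℝ))]
  have hcont : Continuous fun α => ‖characteristicFunction ρ α‖ ^ 2 :=
    (continuous_characteristicFunction hρ).norm.pow 2
  have h0 : ∀ᶠ α in 𝓝 (0 : ℂ), 1 - ε < ‖characteristicFunction ρ α‖ ^ 2 := by
    refine hcont.continuousAt.eventually_const_lt ?_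
    beta_reduce
    rw [characteristicFunction_zero hρ]
    simpa using hε
  obtain ⟨δ, hδ0, hball⟩ := Metric.eventually_nhds_iff.1 h0
  let φ : ContDiffBump (0 : ℂ) := ⟨δ / 2, δ, by positivity, by linarith⟩
  have hφ := hδ φ φ.contDiff φ.hasCompactSupport
  rw [φ.one_of_mem_closedBall (Metric.mem_closedBall_self φ.rIn_pos.le)] at hφ
  have hφq : ∀ α, (1 - ε) * φ α ≤ ‖characteristicFunction ρ α‖ ^ 2 := by
    intro α
    by_cases hα : dist α 0 < δ
    · calc (1 - ε) * φ α ≤ (1 - ε) * 1 :=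
            mul_le_mul_of_nonneg_left φ.le_one (by linarith)
        _ ≤ _ := by rw [mul_one]; exact (hball hα).le
    · rw [φ.zero_of_le_dist (not_lt.1 hα), mul_zero]
      positivity
  filter_upwards [eventually_gt_atTop 0, hφ.eventually_const_lt (show 1 - ε < 1 by linarith)]
    with L hL hL2
  have hint : Integrable fun α => (Ω L).fourier α * φ α :=
    (Ω L).integrable_mul (C := 1) φ.continuous.aestronglyMeasurable fun α => by
      rw [Real.norm_of_nonneg φ.nonneg]; exact φ.le_one
  calc b < (1 - ε) * (1 - ε) := hbε
    _ ≤ (1 - ε) * ∫ α, (Ω L).fourier α * φ α :=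
        mul_le_mul_of_nonneg_left hL2.le (by linarith)
    _ = ∫ α, (1 - ε) * ((Ω L).fourier α * φ α) := (integral_const_mul _ _).symm
    _ ≤ filterOverlap (Ω L) ρ := by
        refine integral_mono_ae (hint.const_mul _) (integrable_filterOverlap _ hρ) ?_
        filter_upwards [(hΩ L hL).fourier_nonneg] with α hα
        rw [mul_left_comm]
        exact mul_le_mul_of_nonneg_left (hφq α) hα

end Limit

end

/-! ### Assembly of the two statements. -/

theorem mainTheorem2 :
    (∀ (Ω : FilterFunction), IsCPTP (filteringMap Ω) →
      ∀ (ρ : FockSpace →L[ℂ] FockSpace), IsDensityOperator ρ →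
        Integrable (filteringIntegrand Ω ρ) ∧
        Integrable (fun α : ℂ => Ω.fourier α * ‖characteristicFunction ρ α‖ ^ 2) ∧
        HasEntanglementFidelity (filteringMap Ω) ρ (filterOverlap Ω ρ) ∧
        filterOverlap Ω ρ ≤ fidelity ρ (filteringMap Ω ρ) ∧
        (∀ ψ : FockSpace, ‖ψ‖ = 1 → ρ = InnerProductSpace.rankOne ℂ ψ ψ →
          ((fidelity ρ (filteringMap Ω ρ) : ℝ) : ℂ) = ⟪ψ, filteringMap Ω ρ ψ⟫_ℂ ∧
          fidelity ρ (filteringMap Ω ρ) = filterOverlap Ω ρ)) ∧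
    (∀ (Ω : ℝ → FilterFunction), (∀ L : ℝ, 0 < L → IsCPTP (filteringMap (Ω L))) →
      TendstoDelta (fun L => (Ω L).fourier) →
      ∀ (ρ : FockSpace →L[ℂ] FockSpace), IsDensityOperator ρ →
        Tendsto (fun L => filterOverlap (Ω L) ρ) atTop (𝓝 1) ∧
        ∀ ε : ℝ, 0 < ε → ∃ L₀ : ℝ, 0 < L₀ ∧ ∀ L : ℝ, L₀ ≤ L →
          1 - ε ≤ filterOverlap (Ω L) ρ ∧
          filterOverlap (Ω L) ρ ≤ fidelity ρ (filteringMap (Ω L) ρ)) := by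
  refine ⟨fun Ω hΩ ρ hρ => ⟨integrable_filteringIntegrand Ω hρ, integrable_filterOverlap Ω hρ,
    hasEntanglementFidelity_filteringMap Ω hρ, hΩ.filterOverlap_le_fidelity hρ, ?_⟩,
    fun Ω hΩ hδ ρ hρ => ⟨tendsto_filterOverlap hΩ hδ hρ, fun ε hε => ?_⟩⟩
  · rintro ψ hψ rfl
    exact ⟨by rw [hΩ.fidelity_pure hψ, inner_filteringMap_pure], hΩ.fidelity_pure hψ⟩
  · obtain ⟨L₁, hL₁⟩ := eventually_atTop.1 ((tendsto_filterOverlap hΩ hδ hρ).eventually_const_lt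
      (show 1 - ε < 1 by linarith))
    -- The maximum with `1` keeps `L` positive, the range where the maps are CPTP.
    refine ⟨max L₁ 1, by positivity, fun L hL => ⟨(hL₁ L ((le_max_left _ _).trans hL)).le, ?_⟩⟩
    exact (hΩ L (one_pos.trans_le ((le_max_right _ _).trans hL))).filterOverlap_le_fidelity hρ
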